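/- Let $Q=(q_{ij})$ be the transition rate matrix of an irreducible continuous-time Markov chain on $\{1,\dots,d\}$ with invariant probability vector $\pi$, let $\lambda_1,\dots,\lambda_d\ge 0$, $\mu_1,\dots,\mu_d>0$ and $\alpha>0$. Consider the Markov-modulated infinite-server queue of Model II: the background process $J$ is a (càdlàg) Markov chain with a given rate matrix, started from $\pi$; given $J$, jobs arrive according to a Poisson process whose rate is the $i$-th arrival rate while $J$ is in state $i$; given $J$ and the arrival times, the job durations are independent, the duration of a job that finds $J$ in state $i$ upon arrival being exponentially distributed with mean $1/\mu_i$. The system starts empty at time $0$, and a job arriving at time $s$ with duration $x$ is present at time $t$ if $s\le t<s+x$. For $N>0$ let $M^{(N)}(t)$ be the number of jobs present at time $t$ in the system with arrival rates $N\lambda_i$, mean durations $1/\mu_i$ and background rate matrix $N^\alpha Q$. Let $p_{ij}(t)=(e^{tQ})_{ij}$, $D_{ij}=\int_0^\infty (p_{ij}(t)-\pi_j)\,dt$, and $$\varrho_i^{(II)}(t)=\frac{\pi_i\lambda_i}{\mu_i}\left(1-e^{-\mu_i t}\right),\qquad \varsigma_i^{(II)}(t)=\sum_{j=1}^d\frac{\lambda_i\lambda_j}{\mu_i+\mu_j}\left(1-e^{-(\mu_i+\mu_j)t}\right)\left(\pi_jD_{ji}+\pi_iD_{ij}\right),$$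 $$v^{(II)}(t,u)=\sum_{i=1}^d e^{-\mu_i u}\left(\varsigma_i^{(II)}(t)\,1_{\{\alpha\le 1\}}+\varrho_i^{(II)}(t)\,1_{\{\alpha\ge 1\}}\right).$$ Then the integrals defining $D$ converge absolutely, $M^{(N)}(s)$ has a finite second moment for all $N>0$ and $s\ge 0$, and for all $t,u\ge 0$, as $N\to\infty$ (through positive real numbers, or along any sequence of positive numbers tending to infinity, for instance the integers), the following hold. (a) $\displaystyle \mathrm{Cov}\left(M^{(N)}(t),M^{(N)}(t+u)\right)=N\sum_{i=1}^d e^{-\mu_i u}\varrho_i^{(II)}(t)+N^{2-\alpha}\sum_{i=1}^d e^{-\mu_i u}\varsigma_i^{(II)}(t)+o\left(N^{2-\alpha}\right).$ (b) If $v^{(II)}(t,u)\neq 0$, then the ratio of the covariance to the two-term expression in (a) tends to $1$, i.e. $$\mathrm{Cov}\left(M^{(N)}(t),M^{(N)}(t+u)\right)\sim N\sum_{i=1}^d e^{-\mu_i u}\varrho_i^{(II)}(t)+N^{2-\alpha}\sum_{i=1}^d e^{-\mu_i u}\varsigma_i^{(II)}(t).$$ (c) $\displaystyle \lim_{N\to\infty}\frac{\mathrm{Cov}\left(M^{(N)}(t),M^{(N)}(t+u)\right)}{N^{\max\{1,2-\alpha\}}}=v^{(II)}(t,u).$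 -/

import Mathlib

open MeasureTheory ProbabilityTheory Filter Topology Asymptotics
open scoped NNReal ENNReal

noncomputable section

namespace MMInfServer

/-- `Q` is the transition rate matrix of an irreducible continuous-time Markov chain on
`{1, …, d}`: nonnegative off-diagonal rates, zero row sums, and every state can be reached from
every other one along positive rates. -/
structure IsIrreducibleGenerator {d : ℕ} (Q : Matrix (Fin d) (Fin d) ℝ) : Prop where
  offDiag_nonneg : ∀ i j, i ≠ j → 0 ≤ Q i j
  row_sum : ∀ i, ∑ j, Q i j = 0
  irreducible : ∀ i j, Relation.ReflTransGen (fun a b => 0 < Q a b) i j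

/-- `p` is an invariant probability vector of the rate matrix `Q`. -/
structure IsInvariantProb {d : ℕ} (Q : Matrix (Fin d) (Fin d) ℝ) (p : Fin d → ℝ) : Prop where
  nonneg : ∀ i, 0 ≤ p i
  sum_eq_one : ∑ i, p i = 1
  invariant : Matrix.vecMul p Q = 0

/-- The transition probabilities `p_{ij}(t)`, i.e. the entries of `exp (t Q)`. -/
def transProb {d : ℕ} (Q : Matrix (Fin d) (Fin d) ℝ) (t : ℝ) (i j : Fin d) : ℝ :=
  NormedSpace.exp (t • Q) i j

/-- The deviation matrix `D_{ij} = ∫_0^∞ (p_{ij}(t) - π_j) dt`. -/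
def deviation {d : ℕ} (Q : Matrix (Fin d) (Fin d) ℝ) (p : Fin d → ℝ) (i j : Fin d) : ℝ :=
  ∫ t in Set.Ioi (0 : ℝ), (transProb Q t i j - p j)

/-- The process `J = (J(t))_{t ≥ 0}` is a (càdlàg) continuous-time Markov chain with rate matrix
`Q` and initial distribution `p`, described by its finite-dimensional distributions. -/
structure IsMarkovChain {d : ℕ} {Ω : Type*} [MeasurableSpace Ω] (P : Measure Ω)
    (Q : Matrix (Fin d) (Fin d) ℝ) (p : Fin d → ℝ) (J : ℝ≥0 → Ω → Fin d) : Prop where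
  measurable : ∀ t, Measurable (J t)
  right_continuous : ∀ ω t, ∀ᶠ s in 𝓝[>] t, J s ω = J t ω
  left_limits : ∀ ω t, ∃ i, ∀ᶠ s in 𝓝[<] t, J s ω = i
  finite_dim : ∀ (k : ℕ) (t : ℕ → ℝ≥0) (i : ℕ → Fin d), Monotone t → t 0 = 0 →
    P.real {ω | ∀ l ≤ k, J (t l) ω = i l} =
      p (i 0) * ∏ l ∈ Finset.range k,
        transProb Q ((t (l + 1) : ℝ) - (t l : ℝ)) (i l) (i (l + 1))

/-- The σ-algebra generated by the whole path of the background process. -/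
abbrev sigmaJ {d : ℕ} {Ω : Type*} (J : ℝ≥0 → Ω → Fin d) : MeasurableSpace Ω :=
  MeasurableSpace.comap (fun ω t => J t ω) MeasurableSpace.pi

/-- The σ-algebra generated by the background process and all arrival times. -/
abbrev sigmaJT {d : ℕ} {Ω : Type*} (J : ℝ≥0 → Ω → Fin d) (T : ℕ → Ω → ℝ≥0∞) :
    MeasurableSpace Ω :=
  sigmaJ J ⊔ MeasurableSpace.comap (fun ω n => T n ω) MeasurableSpace.pi

/-- Model II. `J` is the background chain (started from its invariant law `p`), `T n` is the
arrival time of the `n`-th job (`⊤` if there is no such job) and `S n` its duration. The system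
starts empty.
* Given `J`, the arrivals form a Poisson process on `(0, ∞)` with intensity `lam (J s) ds`: the
  numbers of arrivals in consecutive intervals `(t_l, t_{l+1}]` are independent and Poisson
  distributed with parameters `∫_{t_l}^{t_{l+1}} lam (J s) ds`.
* Given `J` and the arrival times, the durations are independent, and a job that finds the
  background process in state `i` upon arrival has an exponential duration with mean `1 / mu i`. -/
structure IsModelII {d : ℕ} {Ω : Type*} [MeasurableSpace Ω] (P : Measure Ω)
    (Q : Matrix (Fin d) (Fin d) ℝ) (p lam mu : Fin d → ℝ)
    (J : ℝ≥0 → Ω → Fin d) (T : ℕ → Ω → ℝ≥0∞) (S : ℕ → Ω → ℝ≥0) : Prop where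
  background : IsMarkovChain P Q p J
  measurable_arrival : ∀ n, Measurable (T n)
  measurable_duration : ∀ n, Measurable (S n)
  arrival_mono : ∀ ω, Monotone (fun n => T n ω)
  arrival_pos : ∀ ω n, 0 < T n ω
  arrivals : ∀ (k : ℕ) (t : ℕ → ℝ≥0) (m : ℕ → ℕ) (A : Set Ω), Monotone t →
    MeasurableSet[sigmaJ J] A →
    P.real (A ∩ {ω | ∀ l < k,
        {n | (t l : ℝ≥0∞) < T n ω ∧ T n ω ≤ (t (l + 1) : ℝ≥0∞)}.encard = (m l : ℕ∞)}) =
      ∫ ω in A, ∏ l ∈ Finset.range k,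
        (Real.exp (-(∫ s in (t l : ℝ)..(t (l + 1) : ℝ), lam (J s.toNNReal ω))) *
          (∫ s in (t l : ℝ)..(t (l + 1) : ℝ), lam (J s.toNNReal ω)) ^ (m l) /
            ((m l).factorial : ℝ)) ∂P
  durations : ∀ (F : Finset ℕ) (x : ℕ → ℝ≥0) (A : Set Ω),
    MeasurableSet[sigmaJT J T] A → (∀ ω ∈ A, ∀ n ∈ F, T n ω < ⊤) →
    P.real (A ∩ {ω | ∀ n ∈ F, x n < S n ω}) =
      ∫ ω in A, ∏ n ∈ F, Real.exp (-(mu (J (T n ω).toNNReal ω) * (x n : ℝ))) ∂P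

/-- The number `M(t)` of jobs present at time `t`: arrived by time `t` and not yet left. -/
def jobsPresent {Ω : Type*} (T : ℕ → Ω → ℝ≥0∞) (S : ℕ → Ω → ℝ≥0) (t : ℝ≥0) (ω : Ω) : ℕ :=
  {n | T n ω ≤ (t : ℝ≥0∞) ∧ (t : ℝ≥0∞) < T n ω + (S n ω : ℝ≥0∞)}.ncard

/-- `Cov (M(t), M(t + u))`. -/
def covJobs {Ω : Type*} [MeasurableSpace Ω] (P : Measure Ω) (T : ℕ → Ω → ℝ≥0∞)
    (S : ℕ → Ω → ℝ≥0) (t u : ℝ≥0) : ℝ :=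
  covariance (fun ω => (jobsPresent T S t ω : ℝ)) (fun ω => (jobsPresent T S (t + u) ω : ℝ)) P

/-- `ϱ_i(t) = (π_i λ_i / μ_i) (1 - e^{-μ_i t})`. -/
def rhoII {d : ℕ} (p lam mu : Fin d → ℝ) (i : Fin d) (t : ℝ) : ℝ :=
  p i * lam i / mu i * (1 - Real.exp (-(mu i * t)))

/-- `ς_i(t) = ∑_j λ_i λ_j / (μ_i + μ_j) (1 - e^{-(μ_i + μ_j) t}) (π_j D_{ji} + π_i D_{ij})`. -/
def sigmaII {d : ℕ} (Q : Matrix (Fin d) (Fin d) ℝ) (p lam mu : Fin d → ℝ) (i : Fin d)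
    (t : ℝ) : ℝ :=
  ∑ j, lam i * lam j / (mu i + mu j) * (1 - Real.exp (-((mu i + mu j) * t))) *
    (p j * deviation Q p j i + p i * deviation Q p i j)

/-- `v(t, u) = ∑_i e^{-μ_i u} (ς_i(t) 1_{α ≤ 1} + ϱ_i(t) 1_{α ≥ 1})`. -/
def vII {d : ℕ} (Q : Matrix (Fin d) (Fin d) ℝ) (p lam mu : Fin d → ℝ) (α t u : ℝ) : ℝ :=
  ∑ i, Real.exp (-(mu i * u)) *
    ((if α ≤ 1 then sigmaII Q p lam mu i t else 0) + (if 1 ≤ α then rhoII p lam mu i t else 0))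

/-- `N ∑_i e^{-μ_i u} ϱ_i(t) + N^{2-α} ∑_i e^{-μ_i u} ς_i(t)`. -/
def twoTerm {d : ℕ} (Q : Matrix (Fin d) (Fin d) ℝ) (p lam mu : Fin d → ℝ) (α t u N : ℝ) : ℝ :=
  N * ∑ i, Real.exp (-(mu i * u)) * rhoII p lam mu i t +
    N ^ (2 - α) * ∑ i, Real.exp (-(mu i * u)) * sigmaII Q p lam mu i t

end MMInfServer

end

/-! Given the path of `J`, the arrivals are Poisson and the durations independent, so E[M(t) M(t+u)]
splits according to whether the two jobs counted coincide. A single job present at both times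
contributes exactly ∑ e^{-μ_i u} ϱ_i(t). Distinct jobs contribute the integral over (0,t] × (0,t+u]
of E[λ(J_s) λ(J_r)] weighted, inside the expectation, by the two survival probabilities. By
stationarity P(J_s = i, J_r = j) = π_i π_j + K_ij(r-s) with K_ij the `covKernel`, and the π_i π_j
part integrates to the product of the means. What remains of the covariance is the single-job term
plus a double integral against K_ij: this is the exact formula `IsModelII.covJobs_eq`.

The scaling multiplies the first term by N and the second by N², and replaces K_ij(x) by K_ij(N^α
x). As c → ∞, c K(c x) acts as an approximate identity of mass ∫ K (`tendsto_scaled_kernel`), and ∫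
K_ij = π_j D_ji + π_i D_ij. The second term is therefore N^{2-α} times a quantity converging to ∑
e^{-μ_i u} ς_i(t) (`tendsto_modulationTerm`). All three asymptotic claims follow from this
decomposition, `IsModelII.covJobs_scaled`, which is exact for every N.

Integrability of K is exponential ergodicity: by irreducibility all entries of e^Q are positive, so
e^Q contracts the ℓ¹ norm of zero-sum vectors by a factor below 1 (`exists_contraction`).

The model specifies only counts on intervals and durations against fixed thresholds. The counts are
upgraded to Campbell formulas of first and second order, jointly with the path
(`IsModelII.sum_map_points`, `IsModelII.sum_map_points_pair`), by comparing measures on products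
with half-lines. The thresholds are upgraded to random ones such as b - T_n by discretisation
(`IsModelII.measure_durations_random`). -/

noncomputable section

namespace MMInfServer

/-! ### Transition semigroup and exponential ergodicity -/

section Generator

variable {d : ℕ} {Q : Matrix (Fin d) (Fin d) ℝ} {p : Fin d → ℝ}

lemma transProb_smul (c t : ℝ) (i j : Fin d) :
    transProb (c • Q) t i j = transProb Q (c * t) i j := by
  simp only [transProb, smul_smul, mul_comm]

lemma transProb_zero (i j : Fin d) : transProb Q 0 i j = if i = j then 1 else 0 := by
  simp [transProb, Matrix.one_apply]

lemma transProb_add (s t : ℝ) (i j : Fin d) :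
    transProb Q (s + t) i j = ∑ k, transProb Q s i k * transProb Q t k j := by
  have h : Commute (s • Q) (t • Q) := ((Commute.refl Q).smul_left s).smul_right t
  simp only [transProb, add_smul, Matrix.exp_add_of_commute _ _ h, Matrix.mul_apply]

open scoped Matrix.Norms.Operator in
lemma hasSum_exp_entry (A : Matrix (Fin d) (Fin d) ℝ) (i j : Fin d) :
    HasSum (fun n : ℕ => ((n.factorial : ℝ)⁻¹) * (A ^ n) i j) (NormedSpace.exp A i j) := by
  have h := NormedSpace.exp_series_hasSum_exp' (𝕂 := ℝ) A
  exact Pi.hasSum.1 (Pi.hasSum.1 h i) j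

open scoped Matrix.Norms.Operator in
lemma continuous_transProb (i j : Fin d) : Continuous fun t => transProb Q t i j := by
  have h : Continuous fun t : ℝ => NormedSpace.exp (t • Q) :=
    NormedSpace.exp_continuous.comp (continuous_id.smul continuous_const)
  exact (continuous_apply j).comp ((continuous_apply i).comp h)

/-- Q annihilates constant vectors, so only the zeroth term of the exponential series has a nonzero
row sum. The invariant vector is treated in the same way from the left. -/
lemma transProb_row_sum (hQ : IsIrreducibleGenerator Q) (t : ℝ) (i : Fin d) :
    ∑ j, transProb Q t i j = 1 := by
  have h := hasSum_sum (s := Finset.univ) fun j _ => hasSum_exp_entry (t • Q) i j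
  refine h.unique ?_
  convert hasSum_single (0 : ℕ) ?_ using 1
  · simp [Matrix.one_apply]
  · intro n hn
    obtain ⟨m, rfl⟩ := Nat.exists_eq_succ_of_ne_zero hn
    rw [← Finset.mul_sum]
    simp only [Nat.succ_eq_add_one, pow_succ, Matrix.mul_apply]
    rw [Finset.sum_comm]
    simp [← Finset.mul_sum, hQ.row_sum]

lemma invariant_transProb (hp : IsInvariantProb Q p) (t : ℝ) (j : Fin d) :
    ∑ i, p i * transProb Q t i j = p j := by
  have h := hasSum_sum (s := Finset.univ) fun i _ => (hasSum_exp_entry (t • Q) i j).mul_left (p i)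
  refine h.unique ?_
  convert hasSum_single (0 : ℕ) ?_ using 1
  · simp [Matrix.one_apply]
  · intro n hn
    obtain ⟨m, rfl⟩ := Nat.exists_eq_succ_of_ne_zero hn
    have h0 : ∀ k, ∑ i, p i * Q i k = 0 := fun k => congrFun hp.invariant k
    simp only [Nat.succ_eq_add_one, pow_succ', Matrix.mul_apply, Finset.mul_sum]
    rw [Finset.sum_comm]
    refine Finset.sum_eq_zero fun k _ => ?_
    calc ∑ i, p i * ((((m + 1).factorial : ℝ)⁻¹) * ((t • Q) i k * ((t • Q) ^ m) k j))
        = (∑ i, p i * Q i k) * ((((m + 1).factorial : ℝ)⁻¹) * t * ((t • Q) ^ m) k j) := by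
          rw [Finset.sum_mul]
          refine Finset.sum_congr rfl fun i _ => ?_
          simp only [Matrix.smul_apply, smul_eq_mul]
          ring
      _ = 0 := by rw [h0, zero_mul]

lemma pow_entry_nonneg {A : Matrix (Fin d) (Fin d) ℝ} (hA : ∀ i j, 0 ≤ A i j) (n : ℕ) :
    ∀ i j, 0 ≤ (A ^ n) i j := by
  induction n with
  | zero => intro i j; simp only [pow_zero, Matrix.one_apply]; split_ifs <;> norm_num
  | succ n ih =>
    intro i j
    rw [pow_succ, Matrix.mul_apply]
    exact Finset.sum_nonneg fun k _ => mul_nonneg (ih i k) (hA k j)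

lemma exp_entry_nonneg {A : Matrix (Fin d) (Fin d) ℝ} (hA : ∀ i j, 0 ≤ A i j) (i j : Fin d) :
    0 ≤ NormedSpace.exp A i j :=
  (hasSum_exp_entry A i j).nonneg fun n => mul_nonneg (by positivity) (pow_entry_nonneg hA n i j)

lemma exp_entry_pos {A : Matrix (Fin d) (Fin d) ℝ} (hA : ∀ i j, 0 ≤ A i j) {i j : Fin d}
    (h : Relation.ReflTransGen (fun a b => 0 < A a b) i j) : 0 < NormedSpace.exp A i j := by
  obtain ⟨n, hn⟩ : ∃ n : ℕ, 0 < (A ^ n) i j := by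
    induction h with
    | refl => exact ⟨0, by simp⟩
    | @tail b c _ hbc ih =>
      obtain ⟨n, hn⟩ := ih
      refine ⟨n + 1, ?_⟩
      rw [pow_succ, Matrix.mul_apply]
      exact Finset.sum_pos' (fun k _ => mul_nonneg (pow_entry_nonneg hA n i k) (hA k c))
        ⟨b, Finset.mem_univ b, mul_pos hn hbc⟩
  refine lt_of_lt_of_le (mul_pos (by positivity) hn) (le_hasSum (hasSum_exp_entry A i j) n
    fun m _ => mul_nonneg (by positivity) (pow_entry_nonneg hA m i j))

lemma exists_shift (hQ : IsIrreducibleGenerator Q) :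
    ∃ c : ℝ, ∀ i j, 0 ≤ (Q + c • (1 : Matrix (Fin d) (Fin d) ℝ)) i j := by
  refine ⟨∑ i, |Q i i|, fun i j => ?_⟩
  by_cases hij : i = j
  · subst hij
    have h1 : |Q i i| ≤ ∑ i, |Q i i| :=
      Finset.single_le_sum (f := fun i => |Q i i|) (fun _ _ => abs_nonneg _) (Finset.mem_univ i)
    have h2 := neg_abs_le (Q i i)
    simp only [Matrix.add_apply, Matrix.smul_apply, Matrix.one_apply_eq, smul_eq_mul, mul_one]
    linarith
  · simpa [Matrix.one_apply_ne hij] using hQ.offDiag_nonneg i j hij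

/-- The scalar matrix commutes with everything. For suitable c the shifted matrix has nonnegative
entries, so the signs of the entries of e^{tQ} can be read off a series with nonnegative terms. -/
lemma transProb_eq_shift (c t : ℝ) (i j : Fin d) :
    transProb Q t i j = Real.exp (-(t * c)) *
      NormedSpace.exp (t • (Q + c • (1 : Matrix (Fin d) (Fin d) ℝ))) i j := by
  have hc : Commute (t • (Q + c • (1 : Matrix (Fin d) (Fin d) ℝ)))
      (Matrix.diagonal fun _ => -(t * c)) := by
    rw [← Matrix.smul_one_eq_diagonal]
    exact (Commute.one_right _).smul_right _
  have h : t • Q = t • (Q + c • (1 : Matrix (Fin d) (Fin d) ℝ)) +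
      Matrix.diagonal fun _ => -(t * c) := by
    rw [← Matrix.smul_one_eq_diagonal]
    simp [smul_add, smul_smul]
  rw [transProb, h, Matrix.exp_add_of_commute _ _ hc, Matrix.exp_diagonal, Matrix.mul_diagonal,
    mul_comm, Real.exp_eq_exp_ℝ]
  congr 1
  simp [NormedSpace.exp]

lemma transProb_nonneg (hQ : IsIrreducibleGenerator Q) {t : ℝ} (ht : 0 ≤ t) (i j : Fin d) :
    0 ≤ transProb Q t i j := by
  obtain ⟨c, hc⟩ := exists_shift hQ
  rw [transProb_eq_shift c]
  exact mul_nonneg (Real.exp_nonneg _) (exp_entry_nonneg (fun a b => mul_nonneg ht (hc a b)) i j)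

lemma transProb_one_pos (hQ : IsIrreducibleGenerator Q) (i j : Fin d) :
    0 < transProb Q 1 i j := by
  obtain ⟨c, hc⟩ := exists_shift hQ
  rw [transProb_eq_shift c, one_smul]
  refine mul_pos (Real.exp_pos _) ?_
  by_cases hij : i = j
  · exact exp_entry_pos hc (hij ▸ Relation.ReflTransGen.refl)
  -- The shift alters only diagonal entries, and a self-loop in a chain of positive rates can be
  -- dropped.
  have hrefl : ∀ a b, Relation.ReflTransGen (fun a b => 0 < Q a b) a b →
      Relation.ReflTransGen (fun a b => 0 < (Q + c • (1 : Matrix (Fin d) (Fin d) ℝ)) a b) a b := by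
    intro a b h
    induction h with
    | refl => exact .refl
    | @tail b e _ hbe ih =>
      by_cases hb : b = e
      · exact hb ▸ ih
      · exact ih.tail (by simpa [Matrix.one_apply_ne hb] using hbe)
  exact exp_entry_pos hc (hrefl i j (hQ.irreducible i j))

/-- Doeblin's argument: as x sums to zero, δ may be subtracted from every entry of P without
changing xP. The remaining entries are nonnegative and each row sums to 1 - dδ. -/
lemma sum_abs_vecMul_le {P : Matrix (Fin d) (Fin d) ℝ} {δ : ℝ} (hδ : ∀ i j, δ ≤ P i j)
    (hP : ∀ i, ∑ j, P i j = 1) {x : Fin d → ℝ} (hx : ∑ i, x i = 0) :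
    ∑ j, |∑ i, x i * P i j| ≤ (1 - d * δ) * ∑ i, |x i| := by
  have h1 : ∀ j, |∑ i, x i * P i j| ≤ ∑ i, |x i| * (P i j - δ) := fun j => by
    have : ∑ i, x i * P i j = ∑ i, x i * (P i j - δ) := by
      simp [mul_sub, Finset.sum_sub_distrib, ← Finset.sum_mul, hx]
    rw [this]
    refine (Finset.abs_sum_le_sum_abs _ _).trans (Finset.sum_le_sum fun i _ => ?_)
    rw [abs_mul, abs_of_nonneg (sub_nonneg.2 (hδ i j))]
  refine (Finset.sum_le_sum fun j _ => h1 j).trans (le_of_eq ?_)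
  rw [Finset.sum_comm, Finset.mul_sum]
  refine Finset.sum_congr rfl fun i _ => ?_
  rw [← Finset.mul_sum, Finset.sum_sub_distrib, hP]
  simp [mul_comm]

lemma transProb_sub_add (hp : IsInvariantProb Q p) (s t : ℝ) (i j : Fin d) :
    transProb Q (s + t) i j - p j = ∑ k, (transProb Q s i k - p k) * transProb Q t k j := by
  simp only [sub_mul, Finset.sum_sub_distrib, invariant_transProb hp, transProb_add]

lemma sum_transProb_sub (hQ : IsIrreducibleGenerator Q) (hp : IsInvariantProb Q p) (t : ℝ)
    (i : Fin d) : ∑ j, (transProb Q t i j - p j) = 0 := by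
  rw [Finset.sum_sub_distrib, transProb_row_sum hQ, hp.sum_eq_one, sub_self]

lemma exists_contraction (hQ : IsIrreducibleGenerator Q) (hp : IsInvariantProb Q p) :
    ∃ r : ℝ, 0 < r ∧ r < 1 ∧ ∀ t i, ∑ j, |transProb Q (t + 1) i j - p j| ≤
      r * ∑ j, |transProb Q t i j - p j| := by
  have hne : (Finset.univ : Finset (Fin d × Fin d)).Nonempty := by
    rcases Nat.eq_zero_or_pos d with rfl | hd
    · simpa using hp.sum_eq_one
    · exact ⟨(⟨0, hd⟩, ⟨0, hd⟩), Finset.mem_univ _⟩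
  obtain ⟨m, -, hm⟩ := Finset.exists_min_image _
    (fun x : Fin d × Fin d => transProb Q 1 x.1 x.2) hne
  have hd : (0 : ℝ) < d := by exact_mod_cast Fin.pos m.1
  have hpos := transProb_one_pos hQ m.1 m.2
  -- The Doeblin factor may vanish, for instance when d = 1; the maximum with 1/2 keeps r positive,
  -- so that log r can serve as a decay rate.
  refine ⟨max (1 - d * transProb Q 1 m.1 m.2) (1 / 2), by positivity, ?_, fun t i => ?_⟩
  · refine max_lt ?_ (by norm_num)
    have := mul_pos hd hpos
    linarith
  · have h := sum_abs_vecMul_le (P := Matrix.of (transProb Q 1)) (δ := transProb Q 1 m.1 m.2)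
      (fun a b => hm (a, b) (Finset.mem_univ _)) (transProb_row_sum hQ 1)
      (sum_transProb_sub hQ hp t i)
    simp only [transProb_sub_add hp t 1]
    exact h.trans (mul_le_mul_of_nonneg_right (le_max_left _ _)
      (Finset.sum_nonneg fun _ _ => abs_nonneg _))

lemma sum_abs_transProb_sub_le (hQ : IsIrreducibleGenerator Q) (hp : IsInvariantProb Q p)
    {t : ℝ} (ht : 0 ≤ t) (i : Fin d) : ∑ j, |transProb Q t i j - p j| ≤ 2 := by
  calc ∑ j, |transProb Q t i j - p j| ≤ ∑ j, (transProb Q t i j + p j) := by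
        refine Finset.sum_le_sum fun j _ => ?_
        have h1 := transProb_nonneg hQ ht i j
        have h2 := hp.nonneg j
        rw [abs_le]
        constructor <;> linarith
    _ = 2 := by
        rw [Finset.sum_add_distrib, transProb_row_sum hQ, hp.sum_eq_one]; norm_num

lemma integrableOn_transProb_sub (hQ : IsIrreducibleGenerator Q) (hp : IsInvariantProb Q p)
    (i j : Fin d) : IntegrableOn (fun t => transProb Q t i j - p j) (Set.Ioi 0) := by
  obtain ⟨r, hr0, hr1, hr⟩ := exists_contraction hQ hp
  refine integrable_of_isBigO_exp_neg (b := -Real.log r) (neg_pos.2 (Real.log_neg hr0 hr1))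
    ((continuous_transProb i j).sub continuous_const).continuousOn ?_
  -- The 2 bounds the ℓ¹ distance at the fractional part of t. The 1/r pays for replacing ⌊t⌋ unit
  -- steps by t - 1.
  refine IsBigO.of_bound (2 / r) ?_
  filter_upwards [eventually_ge_atTop (0 : ℝ)] with t ht
  have hiter : ∀ (n : ℕ) (s : ℝ), 0 ≤ s → ∑ j, |transProb Q (s + n) i j - p j| ≤ r ^ n * 2 := by
    intro n
    induction n with
    | zero => intro s hs; simpa using sum_abs_transProb_sub_le hQ hp hs i
    | succ n ih =>
      intro s hs
      have := hr (s + n) i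
      rw [Nat.cast_succ, ← add_assoc, pow_succ', mul_assoc]
      exact this.trans (mul_le_mul_of_nonneg_left (ih s hs) hr0.le)
  have h1 := hiter ⌊t⌋₊ (t - ⌊t⌋₊) (sub_nonneg.2 (Nat.floor_le ht))
  rw [sub_add_cancel] at h1
  have h2 : |transProb Q t i j - p j| ≤ ∑ j, |transProb Q t i j - p j| :=
    Finset.single_le_sum (f := fun j => |transProb Q t i j - p j|) (fun _ _ => abs_nonneg _)
      (Finset.mem_univ j)
  rw [Real.norm_eq_abs, Real.norm_eq_abs, Real.abs_exp, neg_neg, ← Real.rpow_def_of_pos hr0]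
  have h3 : r ^ (⌊t⌋₊) ≤ r ^ (t - 1) := by
    rw [← Real.rpow_natCast]
    exact Real.rpow_le_rpow_of_exponent_ge hr0 hr1.le (by linarith [Nat.lt_floor_add_one t])
  rw [Real.rpow_sub hr0, Real.rpow_one] at h3
  calc |transProb Q t i j - p j| ≤ r ^ ⌊t⌋₊ * 2 := h2.trans h1
    _ ≤ r ^ t / r * 2 := by gcongr
    _ = 2 / r * r ^ t := by ring

end Generator

/-! ### Approximate identities on a rectangle -/

section KernelLimit

variable {K g h : ℝ → ℝ} {a b : ℝ}

lemma integral_scaled_kernel {c : ℝ} (hc : 0 < c) (H : ℝ → ℝ) (s : ℝ) :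
    c * ∫ r, H r * K (c * (r - s)) = ∫ x, H (x / c + s) * K x := by
  have h1 : ∫ r, H r * K (c * (r - s)) = ∫ r, H (c * r / c + s) * K (c * r) := by
    rw [← integral_add_right_eq_self (fun r => H r * K (c * (r - s))) s]
    refine integral_congr_ae (ae_of_all _ fun r => ?_)
    simp only [add_sub_cancel_right]
    rw [mul_div_cancel_left₀ r hc.ne']
  rw [h1, Measure.integral_comp_mul_left (fun x => H (x / c + s) * K x) c,
    abs_of_pos (inv_pos.2 hc), smul_eq_mul, mul_inv_cancel_left₀ hc.ne']

lemma tendsto_integral_indicator_kernel (hK : Integrable K) (hh : Continuous h)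
    (hb : ∀ r ∈ Set.Ioc 0 b, |h r| ≤ 1) {s : ℝ} (hs : s ∈ Set.Ioo 0 b) :
    Tendsto (fun c : ℝ => ∫ x, (Set.Ioc 0 b).indicator h (x / c + s) * K x) atTop
      (𝓝 (h s * ∫ x, K x)) := by
  rw [← integral_const_mul]
  have hm : Measurable ((Set.Ioc 0 b).indicator h) := hh.measurable.indicator measurableSet_Ioc
  refine tendsto_integral_filter_of_dominated_convergence (fun x => |K x|) ?_ ?_ hK.abs ?_
  · exact Eventually.of_forall fun c =>
      (hm.comp ((measurable_id.div_const c).add_const s)).aestronglyMeasurable.mul hK.1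
  · refine Eventually.of_forall fun c => ae_of_all _ fun x => ?_
    rw [Real.norm_eq_abs, abs_mul]
    refine mul_le_of_le_one_left (abs_nonneg _) ?_
    by_cases hx : x / c + s ∈ Set.Ioc 0 b
    · rw [Set.indicator_of_mem hx]; exact hb _ hx
    · rw [Set.indicator_of_notMem hx]; simp
  · refine ae_of_all _ fun x => Tendsto.mul_const _ ?_
    have h1 : Tendsto (fun c : ℝ => x / c + s) atTop (𝓝 s) := by
      simpa using (tendsto_const_nhds.div_atTop tendsto_id).add_const s
    refine ((hh.tendsto s).comp h1).congr' ?_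
    filter_upwards [h1.eventually (Ioo_mem_nhds hs.1 hs.2)] with c hc
    rw [Set.indicator_of_mem (Set.Ioo_subset_Ioc_self hc), Function.comp_apply]

/-- After the substitution x = c (r - s) the inner integral evaluates h near s against K, and
dominated convergence applies twice. The bounds on g and h are needed only on the domain of
integration, where the exponentials of the application are at most 1. The condition a ≤ b places
each s < a in the interior of (0, b). -/
lemma tendsto_scaled_kernel (hK : Integrable K) (hKm : Measurable K) (hg : Continuous g)
    (hh : Continuous h) (hab : a ≤ b) (ha : ∀ s ∈ Set.Ioc 0 a, |g s| ≤ 1)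
    (hb : ∀ r ∈ Set.Ioc 0 b, |h r| ≤ 1) :
    Tendsto (fun c : ℝ => c * ∫ s in Set.Ioc 0 a, ∫ r in Set.Ioc 0 b,
      g s * h r * K (c * (r - s))) atTop (𝓝 ((∫ s in Set.Ioc 0 a, g s * h s) * ∫ x, K x)) := by
  have hm : Measurable ((Set.Ioc 0 b).indicator h) := hh.measurable.indicator measurableSet_Ioc
  have hle : ∀ y, |(Set.Ioc 0 b).indicator h y| ≤ 1 := fun y => by
    by_cases hy : y ∈ Set.Ioc 0 b
    · rw [Set.indicator_of_mem hy]; exact hb _ hy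
    · rw [Set.indicator_of_notMem hy]; simp
  have hlim : Tendsto (fun c : ℝ => ∫ s in Set.Ioc 0 a,
      g s * ∫ x, (Set.Ioc 0 b).indicator h (x / c + s) * K x) atTop
      (𝓝 (∫ s in Set.Ioc 0 a, g s * (h s * ∫ x, K x))) := by
    refine tendsto_integral_filter_of_dominated_convergence (fun _ => ∫ x, |K x|) ?_ ?_
      (integrable_const _) ?_
    · refine Eventually.of_forall fun c => hg.aestronglyMeasurable.mul ?_
      refine StronglyMeasurable.aestronglyMeasurable ?_
      refine StronglyMeasurable.integral_prod_right
        (f := fun s x => (Set.Ioc 0 b).indicator h (x / c + s) * K x)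
            (Measurable.stronglyMeasurable ?_)
      exact (hm.comp ((measurable_snd.div_const c).add measurable_fst)).mul
        (hKm.comp measurable_snd)
    · refine Eventually.of_forall fun c => ?_
      filter_upwards [ae_restrict_mem measurableSet_Ioc] with s hs
      rw [Real.norm_eq_abs, abs_mul]
      refine (mul_le_of_le_one_left (abs_nonneg _) (ha s hs)).trans ?_
      refine (abs_integral_le_integral_abs).trans (integral_mono_of_nonneg
        (ae_of_all _ fun _ => abs_nonneg _) hK.abs (ae_of_all _ fun x => ?_))
      simp only [abs_mul]
      exact mul_le_of_le_one_left (abs_nonneg _) (hle _)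
    -- The endpoint s = a is discarded as a null set: if a = b, only the mass of K on one side of 0
    -- would be seen there.
    · rw [← restrict_Ioo_eq_restrict_Ioc]
      filter_upwards [ae_restrict_mem measurableSet_Ioo] with s hs
      exact (tendsto_integral_indicator_kernel hK hh hb ⟨hs.1, hs.2.trans_le hab⟩).const_mul _
  have heq : (∫ s in Set.Ioc 0 a, g s * h s) * ∫ x, K x =
      ∫ s in Set.Ioc 0 a, g s * (h s * ∫ x, K x) := by
    rw [← integral_mul_const]
    simp only [mul_assoc]
  rw [heq]
  refine hlim.congr' ?_
  filter_upwards [eventually_gt_atTop (0 : ℝ)] with c hc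
  rw [← integral_const_mul]
  refine integral_congr_ae (ae_of_all _ fun s => ?_)
  simp only
  rw [← integral_scaled_kernel hc, mul_left_comm, ← integral_const_mul,
    ← integral_indicator measurableSet_Ioc]
  congr 2
  funext r
  by_cases hr : r ∈ Set.Ioc 0 b
  · simp only [Set.indicator_of_mem hr, mul_assoc]
  · simp [Set.indicator_of_notMem hr]

end KernelLimit

/-! ### Stationary covariances of the background states -/

section CovKernel

variable {d : ℕ} {Q : Matrix (Fin d) (Fin d) ℝ} {p : Fin d → ℝ}

/-- The covariance of the indicators of `J s = i` and `J r = j` for a stationary chain `J` with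
generator `Q`, as a function of `r - s`. -/
def covKernel (Q : Matrix (Fin d) (Fin d) ℝ) (p : Fin d → ℝ) (i j : Fin d) (x : ℝ) : ℝ :=
  if 0 < x then p i * (transProb Q x i j - p j) else p j * (transProb Q (-x) j i - p i)

lemma measurable_covKernel (i j : Fin d) : Measurable (covKernel Q p i j) :=
  Measurable.ite measurableSet_Ioi
    (((continuous_transProb i j).measurable.sub_const _).const_mul _)
    ((((continuous_transProb j i).measurable.comp measurable_neg).sub_const _).const_mul _)

lemma covKernel_eqOn_Ioi (i j : Fin d) : Set.EqOn (covKernel Q p i j)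
    (fun x => p i * (transProb Q x i j - p j)) (Set.Ioi 0) :=
  fun _ hx => if_pos hx

lemma covKernel_eqOn_Iic (i j : Fin d) : Set.EqOn (covKernel Q p i j)
    (fun x => p j * (transProb Q (-x) j i - p i)) (Set.Iic 0) :=
  fun _ hx => if_neg (not_lt.2 hx)

lemma integrableOn_covKernel_Ioi (hQ : IsIrreducibleGenerator Q) (hp : IsInvariantProb Q p)
    (i j : Fin d) : IntegrableOn (covKernel Q p i j) (Set.Ioi 0) :=
  (integrableOn_congr_fun (covKernel_eqOn_Ioi i j) measurableSet_Ioi).2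
    ((integrableOn_transProb_sub hQ hp i j).const_mul _)

lemma integrableOn_covKernel_Iic (hQ : IsIrreducibleGenerator Q) (hp : IsInvariantProb Q p)
    (i j : Fin d) : IntegrableOn (covKernel Q p i j) (Set.Iic 0) := by
  refine (integrableOn_congr_fun (covKernel_eqOn_Iic i j) measurableSet_Iic).2 ?_
  refine Integrable.const_mul ?_ _
  have h := (integrableOn_Ici_iff_integrableOn_Ioi (by finiteness)).2
    (integrableOn_transProb_sub hQ hp j i)
  exact IntegrableOn.comp_neg_Iic (c := 0) (f := fun t => transProb Q t j i - p i) (by rwa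
      [neg_zero])

lemma integrable_covKernel (hQ : IsIrreducibleGenerator Q) (hp : IsInvariantProb Q p)
    (i j : Fin d) : Integrable (covKernel Q p i j) := by
  rw [← integrableOn_univ, ← Set.Iic_union_Ioi (a := (0 : ℝ))]
  exact (integrableOn_covKernel_Iic hQ hp i j).union (integrableOn_covKernel_Ioi hQ hp i j)

/-- Each half-line contributes one entry of the deviation matrix; negative lags exchange the roles
of i and j. -/
lemma integral_covKernel (hQ : IsIrreducibleGenerator Q) (hp : IsInvariantProb Q p)
    (i j : Fin d) :
    ∫ x, covKernel Q p i j x = p j * deviation Q p j i + p i * deviation Q p i j := by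
  rw [← intervalIntegral.integral_Iic_add_Ioi (integrableOn_covKernel_Iic hQ hp i j)
    (integrableOn_covKernel_Ioi hQ hp i j),
    setIntegral_congr_fun measurableSet_Iic (covKernel_eqOn_Iic i j),
    setIntegral_congr_fun measurableSet_Ioi (covKernel_eqOn_Ioi i j),
    integral_const_mul, integral_const_mul, deviation, deviation,
    integral_comp_neg_Iic 0 (fun x => transProb Q x j i - p i), neg_zero]

lemma prob_le_one (hp : IsInvariantProb Q p) (i : Fin d) : p i ≤ 1 :=
  hp.sum_eq_one ▸ Finset.single_le_sum (fun j _ => hp.nonneg j) (Finset.mem_univ i)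

lemma abs_covKernel_le (hQ : IsIrreducibleGenerator Q) (hp : IsInvariantProb Q p)
    (i j : Fin d) (x : ℝ) : |covKernel Q p i j x| ≤ 2 := by
  have key : ∀ {y : ℝ} (_ : 0 ≤ y) (k l : Fin d), |p k * (transProb Q y k l - p l)| ≤ 2 := by
    intro y hy k l
    rw [abs_mul, abs_of_nonneg (hp.nonneg k)]
    refine (mul_le_of_le_one_left (abs_nonneg _) (prob_le_one hp k)).trans ?_
    exact (Finset.single_le_sum (f := fun l => |transProb Q y k l - p l|)
      (fun _ _ => abs_nonneg _) (Finset.mem_univ l)).trans (sum_abs_transProb_sub_le hQ hp hy k)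
  unfold covKernel
  split_ifs with hx
  · exact key hx.le i j
  · exact key (by linarith) j i

end CovKernel

/-! ### Measurability on the space of right-continuous paths -/

section PathSpace

variable {d : ℕ}

/-- Right-continuous paths in the state space `{1, …, d}`. -/
abbrev RCPath (d : ℕ) : Type := {w : ℝ≥0 → Fin d // ∀ t, ∀ᶠ s in 𝓝[>] t, w s = w t}

/-- These are points of the grid of mesh 1/(k+1) lying strictly to the right of s. They discretise
time along right-continuous paths, and later the random duration thresholds. -/
lemma tendsto_floor_succ_div (s : ℝ≥0) :
    Tendsto (fun k : ℕ => ((⌊(k + 1 : ℝ≥0) * s⌋₊ : ℝ≥0) + 1) / (k + 1)) atTop (𝓝[>] s) := by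
  have hlt : ∀ k : ℕ, s < ((⌊(k + 1 : ℝ≥0) * s⌋₊ : ℝ≥0) + 1) / (k + 1) := fun k => by
    rw [lt_div_iff₀ (by positivity), mul_comm]
    exact Nat.lt_floor_add_one _
  refine tendsto_nhdsWithin_iff.2 ⟨?_, Eventually.of_forall hlt⟩
  refine tendsto_of_tendsto_of_tendsto_of_le_of_le (g := fun _ => s)
    (h := fun k : ℕ => s + 1 / (k + 1)) tendsto_const_nhds ?_ (fun k => (hlt k).le) fun k => ?_
  · simpa using (tendsto_one_div_add_atTop_nhds_zero_nat (𝕜 := ℝ≥0)).const_add s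
  · simp only
    rw [add_div]
    gcongr
    rw [div_le_iff₀ (by positivity), mul_comm]
    exact Nat.floor_le (by positivity)

/-- By right continuity, evaluation is the limit of maps that read the path only at countably many
grid times; each of those is jointly measurable. -/
lemma measurable_pathEval_nnreal : Measurable fun x : RCPath d × ℝ≥0 => x.1.1 x.2 := by
  refine measurable_of_tendsto_metrizable (f := fun (k : ℕ) (x : RCPath d × ℝ≥0) =>
    x.1.1 (((⌊(k + 1 : ℝ≥0) * x.2⌋₊ : ℝ≥0) + 1) / (k + 1))) (fun k => ?_) ?_
  · have h1 : Measurable fun y : RCPath d × ℕ => y.1.1 (((y.2 : ℝ≥0) + 1) / (k + 1)) :=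
      measurable_from_prod_countable_left fun n =>
        (measurable_pi_apply (((n : ℝ≥0) + 1) / (k + 1))).comp measurable_subtype_coe
    exact h1.comp (measurable_fst.prodMk
      (Nat.measurable_floor.comp (measurable_snd.const_mul (k + 1 : ℝ≥0))))
  · rw [tendsto_pi_nhds]
    intro x
    refine tendsto_const_nhds.congr' ?_
    filter_upwards [(tendsto_floor_succ_div x.2).eventually (x.1.2 x.2)] with k hk
    exact hk.symm

lemma measurable_pathEval : Measurable fun x : RCPath d × ℝ => x.1.1 x.2.toNNReal :=
  measurable_pathEval_nnreal.comp (measurable_fst.prodMk (measurable_real_toNNReal.comp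
      measurable_snd))

lemma measurable_pathEval_left (w : RCPath d) : Measurable fun s : ℝ => w.1 s.toNNReal :=
  measurable_pathEval.comp measurable_prodMk_left

end PathSpace

/-! ### Cumulative arrival rates -/

section Rate

variable {d : ℕ} {lam : Fin d → ℝ}

/-- The cumulative intensity `∫_a^b lam (w s) ds` along a path. -/
def cumRate (lam : Fin d → ℝ) (w : RCPath d) (a b : ℝ≥0) : ℝ :=
  ∫ s in (a : ℝ)..(b : ℝ), lam (w.1 s.toNNReal)

lemma intervalIntegrable_rate (w : RCPath d) (a b : ℝ) :
    IntervalIntegrable (fun s => lam (w.1 s.toNNReal)) volume a b := by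
  rw [intervalIntegrable_iff]
  have : IsFiniteMeasure (volume.restrict (Set.uIoc a b)) := ⟨by simp [Set.uIoc]⟩
  refine Integrable.of_bound ((measurable_of_finite lam).comp
    (measurable_pathEval_left w)).aestronglyMeasurable (∑ i, |lam i|) (ae_of_all _ fun s => ?_)
  exact Finset.single_le_sum (f := fun i => |lam i|) (fun _ _ => abs_nonneg _) (Finset.mem_univ _)

lemma cumRate_add (w : RCPath d) (a b c : ℝ≥0) :
    cumRate lam w a b + cumRate lam w b c = cumRate lam w a c :=
  intervalIntegral.integral_add_adjacent_intervals (intervalIntegrable_rate w _ _)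
    (intervalIntegrable_rate w _ _)

lemma cumRate_nonneg (hlam : ∀ i, 0 ≤ lam i) (w : RCPath d) {a b : ℝ≥0} (hab : a ≤ b) :
    0 ≤ cumRate lam w a b :=
  intervalIntegral.integral_nonneg (NNReal.coe_le_coe.2 hab) fun _ _ => hlam _

lemma measurable_cumRate {a b : ℝ≥0} (hab : a ≤ b) :
    Measurable fun w : RCPath d => cumRate lam w a b := by
  simp only [cumRate, intervalIntegral.integral_of_le (NNReal.coe_le_coe.2 hab)]
  exact (StronglyMeasurable.integral_prod_right
    (f := fun (w : RCPath d) (s : ℝ) => lam (w.1 s.toNNReal))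
    ((measurable_of_finite lam).comp measurable_pathEval).stronglyMeasurable).measurable

lemma ofReal_cumRate (hlam : ∀ i, 0 ≤ lam i) (w : RCPath d) (b : ℝ≥0) :
    ENNReal.ofReal (cumRate lam w 0 b) =
      ∫⁻ s in Set.Ioc (0 : ℝ) b, ENNReal.ofReal (lam (w.1 s.toNNReal)) := by
  have h := (intervalIntegrable_rate (lam := lam) w (0 : ℝ) b).1
  rw [cumRate, NNReal.coe_zero, intervalIntegral.integral_of_le b.coe_nonneg,
    ofReal_integral_eq_lintegral_ofReal h (ae_of_all _ fun _ => hlam _)]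

end Rate

/-! ### Poisson moments and mixtures -/

section Poisson

/-- The Poisson probabilities as extended nonnegative reals. -/
def poissonWeight (x : ℝ) (n : ℕ) : ℝ≥0∞ :=
  ENNReal.ofReal (Real.exp (-x) * x ^ n / n.factorial)

variable {x : ℝ}

lemma tsum_poissonWeight (hx : 0 ≤ x) : ∑' n, poissonWeight x n = 1 := by
  have h := (NormedSpace.expSeries_div_hasSum_exp x).mul_left (Real.exp (-x))
  rw [← Real.exp_eq_exp_ℝ, ← Real.exp_add, neg_add_cancel, Real.exp_zero] at h
  simp only [poissonWeight, mul_div_assoc]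
  rw [← ENNReal.ofReal_tsum_of_nonneg (fun n => by positivity) h.summable, h.tsum_eq,
    ENNReal.ofReal_one]

/-- The size-bias identity: weighting by n shifts the Poisson law by one. The first two moments
follow by reindexing. -/
lemma succ_mul_poissonWeight (hx : 0 ≤ x) (n : ℕ) :
    ((n + 1 : ℕ) : ℝ≥0∞) * poissonWeight x (n + 1) = ENNReal.ofReal x * poissonWeight x n := by
  rw [poissonWeight, poissonWeight, ← ENNReal.ofReal_natCast, ← ENNReal.ofReal_mul (by positivity),
    ← ENNReal.ofReal_mul hx, Nat.factorial_succ]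
  congr 1
  have : (n.factorial : ℝ) ≠ 0 := by positivity
  push_cast
  field_simp
  ring

lemma tsum_mul_poissonWeight (hx : 0 ≤ x) :
    ∑' n : ℕ, (n : ℝ≥0∞) * poissonWeight x n = ENNReal.ofReal x := by
  rw [tsum_eq_zero_add' ENNReal.summable]
  simp only [succ_mul_poissonWeight hx, ENNReal.tsum_mul_left, tsum_poissonWeight hx]
  simp

lemma tsum_sq_mul_poissonWeight (hx : 0 ≤ x) :
    ∑' n : ℕ, (n : ℝ≥0∞) * n * poissonWeight x n =
      ENNReal.ofReal x * ENNReal.ofReal x + ENNReal.ofReal x := by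
  rw [tsum_eq_zero_add' ENNReal.summable]
  simp only [mul_assoc, succ_mul_poissonWeight hx]
  have h : ∀ n : ℕ, ((n + 1 : ℕ) : ℝ≥0∞) * (ENNReal.ofReal x * poissonWeight x n) =
      ENNReal.ofReal x * (n * poissonWeight x n) + ENNReal.ofReal x * poissonWeight x n :=
    fun n => by push_cast; ring
  simp only [h, ENNReal.tsum_add, ENNReal.tsum_mul_left, tsum_mul_poissonWeight hx,
    tsum_poissonWeight hx]
  simp

lemma poissonWeight_toReal_le_one (hx : 0 ≤ x) (n : ℕ) :
    Real.exp (-x) * x ^ n / n.factorial ≤ 1 := by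
  have h : poissonWeight x n ≤ 1 := tsum_poissonWeight hx ▸ ENNReal.le_tsum n
  exact ENNReal.ofReal_le_one.1 h

end Poisson

section Counting

variable {Ω : Type*} [MeasurableSpace Ω] {P : Measure Ω}

lemma lintegral_tsum_tsum {g : ℕ → ℕ → Ω → ℝ≥0∞} (hg : ∀ a b, Measurable (g a b)) :
    ∫⁻ ω, ∑' a, ∑' b, g a b ω ∂P = ∑' a, ∑' b, ∫⁻ ω, g a b ω ∂P := by
  rw [lintegral_tsum fun a => (Measurable.tsum fun b => hg a b).aemeasurable]
  exact tsum_congr fun a => lintegral_tsum fun b => (hg a b).aemeasurable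

/-- If the joint law of two `ℝ≥0∞`-valued variables on the event `A` is a mixture of products of
Poisson laws, then expectations on `A` are the corresponding mixtures. -/
lemma setLIntegral_of_poisson [IsFiniteMeasure P] {A : Set Ω} (hA : MeasurableSet A)
    {X Y : Ω → ℝ≥0∞} (hX : Measurable X) (hY : Measurable Y) {x y : Ω → ℝ}
    (hxm : Measurable x) (hym : Measurable y) (hx : ∀ ω, 0 ≤ x ω) (hy : ∀ ω, 0 ≤ y ω)
    (h : ∀ a b : ℕ, P (A ∩ {ω | X ω = a ∧ Y ω = b}) =
      ∫⁻ ω in A, poissonWeight (x ω) a * poissonWeight (y ω) b ∂P) (f : ℝ≥0∞ → ℝ≥0∞ → ℝ≥0∞) :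
    ∫⁻ ω in A, f (X ω) (Y ω) ∂P =
      ∫⁻ ω in A, ∑' a : ℕ, ∑' b : ℕ, f a b * (poissonWeight (x ω) a * poissonWeight (y ω) b) ∂P :=
          by
  have hm : ∀ {z : Ω → ℝ}, Measurable z → ∀ a, Measurable fun ω => poissonWeight (z ω) a :=
    fun {z} hz a => by unfold poissonWeight; fun_prop
  have hxy : ∀ a b, Measurable fun ω => poissonWeight (x ω) a * poissonWeight (y ω) b :=
    fun a b => (hm hxm a).mul (hm hym b)
  have hD : ∀ c : ℕ × ℕ, MeasurableSet (A ∩ {ω | X ω = c.1 ∧ Y ω = c.2}) := fun c =>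
    hA.inter ((hX (measurableSet_singleton _)).inter (hY (measurableSet_singleton _)))
  have hdisj : Pairwise (Function.onFun Disjoint
      fun c : ℕ × ℕ => A ∩ {ω | X ω = c.1 ∧ Y ω = c.2}) := by
    intro c c' hc
    refine Set.disjoint_left.2 fun ω h1 h2 => hc ?_
    exact Prod.ext (Nat.cast_injective (R := ℝ≥0∞) (h1.2.1.symm.trans h2.2.1))
      (Nat.cast_injective (R := ℝ≥0∞) (h1.2.2.symm.trans h2.2.2))
  -- The Poisson weights sum to 1, so the atoms with natural values exhaust A up to a null set. In
  -- particular infinite values are negligible.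
  have hmass : P (⋃ c : ℕ × ℕ, A ∩ {ω | X ω = c.1 ∧ Y ω = c.2}) = P A := by
    rw [measure_iUnion hdisj hD, ENNReal.tsum_prod']
    simp only [h]
    calc ∑' a, ∑' b, ∫⁻ ω in A, poissonWeight (x ω) a * poissonWeight (y ω) b ∂P
        = ∫⁻ ω in A, ∑' a, ∑' b, poissonWeight (x ω) a * poissonWeight (y ω) b ∂P := by
          exact (lintegral_tsum_tsum hxy).symm
      _ = P A := by
          simp only [ENNReal.tsum_mul_left, tsum_poissonWeight (hy _), mul_one,
            tsum_poissonWeight (hx _), lintegral_const, Measure.restrict_apply_univ, one_mul]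
  have hae : (⋃ c : ℕ × ℕ, A ∩ {ω | X ω = c.1 ∧ Y ω = c.2}) =ᵐ[P] A :=
    ae_eq_of_subset_of_measure_ge (Set.iUnion_subset fun _ => Set.inter_subset_left) hmass.ge
      (MeasurableSet.iUnion hD).nullMeasurableSet (measure_ne_top _ _)
  rw [← setLIntegral_congr hae, lintegral_iUnion hD hdisj, ENNReal.tsum_prod',
    lintegral_tsum_tsum (g := fun a b ω => f a b * (poissonWeight (x ω) a * poissonWeight (y ω) b))
      fun a b => (hxy a b).const_mul _]
  refine tsum_congr fun a => tsum_congr fun b => ?_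
  rw [lintegral_const_mul _ (hxy a b), ← h a b,
    setLIntegral_congr_fun (g := fun _ => f a b) (hD (a, b)), setLIntegral_const]
  intro ω hω
  simp only [hω.2.1, hω.2.2]

end Counting

/-! ### Counts of arrivals in intervals -/

section PointCount

variable {Ω : Type*}

/-- The number of points of `T` in `(a, b]`, as an extended nonnegative real. -/
def pointCount (T : ℕ → Ω → ℝ≥0∞) (a b : ℝ≥0) (ω : Ω) : ℝ≥0∞ :=
  ∑' n, {n | (a : ℝ≥0∞) < T n ω ∧ T n ω ≤ b}.indicator 1 n

variable {T : ℕ → Ω → ℝ≥0∞}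

lemma tsum_indicator_eq_encard (s : Set ℕ) : ∑' n, s.indicator (1 : ℕ → ℝ≥0∞) n = s.encard := by
  rw [← tsum_subtype]
  exact ENNReal.tsum_set_one s

lemma pointCount_eq_natCast_iff (a b : ℝ≥0) (ω : Ω) (m : ℕ) :
    pointCount T a b ω = m ↔
      {n | (a : ℝ≥0∞) < T n ω ∧ T n ω ≤ (b : ℝ≥0∞)}.encard = (m : ℕ∞) := by
  rw [pointCount, tsum_indicator_eq_encard]
  exact_mod_cast Iff.rfl

lemma measurable_pointCount [MeasurableSpace Ω] {T : ℕ → Ω → ℝ≥0∞} (hT : ∀ n, Measurable (T n)) (a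
    b : ℝ≥0) :
    Measurable (pointCount T a b) := by
  refine Measurable.tsum fun n => ?_
  exact Measurable.indicator (s := {ω | (a : ℝ≥0∞) < T n ω ∧ T n ω ≤ b}) (f := fun _ => (1 : ℝ≥0∞))
    measurable_const ((measurableSet_lt measurable_const (hT n)).inter
      (measurableSet_le (hT n) measurable_const))

lemma pointCount_add {a b c : ℝ≥0} (hab : a ≤ b) (hbc : b ≤ c) (ω : Ω) :
    pointCount T a b ω + pointCount T b c ω = pointCount T a c ω := by
  rw [pointCount, pointCount, pointCount, ← ENNReal.tsum_add]
  refine tsum_congr fun n => ?_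
  have h1 : (a : ℝ≥0∞) ≤ b := by exact_mod_cast hab
  have h2 : (b : ℝ≥0∞) ≤ c := by exact_mod_cast hbc
  by_cases h : T n ω ≤ b
  · have hc := h.trans h2
    simp [Set.indicator_apply, h, hc, not_lt.2 h]
  · have hb := not_le.1 h
    simp [Set.indicator_apply, h, hb, h1.trans_lt hb]

end PointCount

/-! ### Measures determined by products with half-lines -/

section Extensionality

variable {X : Type*} [MeasurableSpace X]

/-- For fixed B, the measure C ↦ μ (B × C) on the line is finite, hence determined by half-lines;
measurable rectangles then determine μ. -/
lemma measure_ext_of_prod_Iic {μ ν : Measure (X × ℝ)} [IsFiniteMeasure μ]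
    (h : ∀ B, MeasurableSet B → ∀ a, μ (B ×ˢ Set.Iic a) = ν (B ×ˢ Set.Iic a)) : μ = ν := by
  refine Measure.ext_prod fun {B C} hB hC => ?_
  have key : (μ.restrict (B ×ˢ Set.univ)).map Prod.snd = (ν.restrict (B ×ˢ Set.univ)).map Prod.snd
      := by
    refine Measure.ext_of_Iic _ _ fun a => ?_
    rw [Measure.map_apply measurable_snd measurableSet_Iic,
      Measure.map_apply measurable_snd measurableSet_Iic,
      Measure.restrict_apply (measurable_snd measurableSet_Iic),
      Measure.restrict_apply (measurable_snd measurableSet_Iic)]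
    convert h B hB a using 2 <;> (ext x; simp [and_comm])
  have := congrArg (fun m => m C) key
  simp only [Measure.map_apply measurable_snd hC,
    Measure.restrict_apply (measurable_snd hC)] at this
  convert this using 2 <;> (ext x; simp [and_comm])

/-- The previous lemma is used twice: once with the last coordinate split off, and once on the slice
where that coordinate is confined to a half-line. -/
lemma measure_ext_of_prod_Iic_Iic {μ ν : Measure (X × ℝ × ℝ)} [IsFiniteMeasure μ]
    (h : ∀ B, MeasurableSet B → ∀ a b,
      μ (B ×ˢ Set.Iic a ×ˢ Set.Iic b) = ν (B ×ˢ Set.Iic a ×ˢ Set.Iic b)) : μ = ν := by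
  have hmap : ∀ (ρ : Measure (X × ℝ × ℝ)) (B : Set (X × ℝ)) (b : ℝ), MeasurableSet B →
      ρ.map MeasurableEquiv.prodAssoc.symm (B ×ˢ Set.Iic b) =
        ρ (MeasurableEquiv.prodAssoc.symm ⁻¹' (B ×ˢ Set.Iic b)) := fun ρ B b hB =>
    Measure.map_apply (MeasurableEquiv.measurable _) (hB.prod measurableSet_Iic)
  have key : μ.map MeasurableEquiv.prodAssoc.symm = ν.map MeasurableEquiv.prodAssoc.symm := by
    refine measure_ext_of_prod_Iic fun B hB b => ?_
    have h2 : ((μ.map MeasurableEquiv.prodAssoc.symm).restrict (Set.univ ×ˢ Set.Iic b)).map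
        Prod.fst =
        ((ν.map MeasurableEquiv.prodAssoc.symm).restrict (Set.univ ×ˢ Set.Iic b)).map Prod.fst := by
      refine measure_ext_of_prod_Iic fun C hC a => ?_
      have hm : MeasurableSet (C ×ˢ Set.Iic a) := hC.prod measurableSet_Iic
      rw [Measure.map_apply measurable_fst hm, Measure.map_apply measurable_fst hm,
        Measure.restrict_apply (measurable_fst hm), Measure.restrict_apply (measurable_fst hm)]
      have he : Prod.fst ⁻¹' (C ×ˢ Set.Iic a) ∩ Set.univ ×ˢ Set.Iic b =
          (C ×ˢ Set.Iic a) ×ˢ Set.Iic b := by ext x; simp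
      rw [he, hmap _ _ _ hm, hmap _ _ _ hm]
      convert h C hC a b using 2 <;>
        (ext x; simp [MeasurableEquiv.prodAssoc])
    have := congrArg (fun m => m B) h2
    simp only [Measure.map_apply measurable_fst hB,
      Measure.restrict_apply (measurable_fst hB)] at this
    convert this using 2 <;> (ext x; simp)
  exact MeasurableEquiv.prodAssoc.symm.map_measurableEquiv_injective key

end Extensionality

/-! ### Conditional moments of the arrival counts -/

section Campbell

variable {d : ℕ} {Ω : Type*} [mΩ : MeasurableSpace Ω] {P : Measure Ω}
  {Q : Matrix (Fin d) (Fin d) ℝ} {p lam mu : Fin d → ℝ} {J : ℝ≥0 → Ω → Fin d}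
  {T : ℕ → Ω → ℝ≥0∞} {S : ℕ → Ω → ℝ≥0}

/-- The path of the background process as an element of the path space. -/
def IsMarkovChain.path (h : IsMarkovChain P Q p J) (ω : Ω) : RCPath d :=
  ⟨fun t => J t ω, h.right_continuous ω⟩

lemma IsMarkovChain.measurable_path_sigmaJ (h : IsMarkovChain P Q p J) :
    Measurable[sigmaJ J] h.path :=
  Measurable.subtype_mk (comap_measurable (fun ω t => J t ω))

lemma IsMarkovChain.sigmaJ_le (h : IsMarkovChain P Q p J) : sigmaJ J ≤ mΩ :=
  (measurable_pi_lambda _ h.measurable).comap_le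

lemma IsMarkovChain.measurable_path (h : IsMarkovChain P Q p J) : Measurable h.path :=
  h.measurable_path_sigmaJ.mono h.sigmaJ_le le_rfl

lemma IsModelII.measure_pointCount [IsFiniteMeasure P] (hM : IsModelII P Q p lam mu J T S)
    (hlam : ∀ i, 0 ≤ lam i) {B : Set (RCPath d)} (hB : MeasurableSet B) {s r : ℝ≥0} (hsr : s ≤ r)
    (a b : ℕ) :
    P (hM.background.path ⁻¹' B ∩ {ω | pointCount T 0 s ω = a ∧ pointCount T s r ω = b}) =
      ∫⁻ ω in hM.background.path ⁻¹' B, poissonWeight (cumRate lam (hM.background.path ω) 0 s) a *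
        poissonWeight (cumRate lam (hM.background.path ω) s r) b ∂P := by
  set φ := hM.background.path with hφ
  -- Two adjacent intervals, (0, s] and (s, r], suffice for second moments. The time sequence stays
  -- at r afterwards.
  have h := hM.arrivals 2 (fun l => if l = 0 then 0 else if l = 1 then s else r)
    (fun l => if l = 0 then a else b) (φ ⁻¹' B) ?_ (hM.background.measurable_path_sigmaJ hB)
  · have hset : ∀ ω, (∀ l < 2, {n | (((if l = 0 then 0 else if l = 1 then s else r) : ℝ≥0) : ℝ≥0∞) <
          T n ω ∧ T n ω ≤ (((if l + 1 = 0 then 0 else if l + 1 = 1 then s else r) : ℝ≥0) :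
              ℝ≥0∞)}.encard =
          ((if l = 0 then a else b : ℕ) : ℕ∞)) ↔
        (pointCount T 0 s ω = a ∧ pointCount T s r ω = b) := by
      intro ω
      rw [pointCount_eq_natCast_iff, pointCount_eq_natCast_iff]
      refine ⟨fun h => ⟨by simpa using h 0 (by norm_num), by simpa using h 1 (by norm_num)⟩, ?_⟩
      rintro ⟨h0, h1⟩ l hl
      interval_cases l
      · simpa using h0
      · simpa using h1
    simp only [hset, Finset.prod_range_succ, Finset.prod_range_zero, one_mul] at h
    simp only [↓reduceIte, zero_add, one_ne_zero, Nat.reduceAdd, OfNat.ofNat_ne_zero,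
      OfNat.ofNat_ne_one] at h
    rw [← ENNReal.ofReal_toReal (measure_ne_top P _)]
    change ENNReal.ofReal (P.real _) = _
    rw [h]
    have h0 : ∀ ω, 0 ≤ cumRate lam (φ ω) 0 s := fun ω => cumRate_nonneg hlam _ bot_le
    have h1 : ∀ ω, 0 ≤ cumRate lam (φ ω) s r := fun ω => cumRate_nonneg hlam _ hsr
    have hm0 := (measurable_cumRate (lam := lam) (a := 0) (b := s) bot_le).comp
      hM.background.measurable_path
    have hm1 := (measurable_cumRate (lam := lam) hsr).comp hM.background.measurable_path
    have hnn : ∀ {x : ℝ} (n : ℕ), 0 ≤ x → 0 ≤ Real.exp (-x) * x ^ n / n.factorial :=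
      fun n hx => by positivity
    change ENNReal.ofReal (∫ ω in φ ⁻¹' B, Real.exp (-cumRate lam (φ ω) 0 s) *
      cumRate lam (φ ω) 0 s ^ a / (a.factorial : ℝ) * (Real.exp (-cumRate lam (φ ω) s r) *
      cumRate lam (φ ω) s r ^ b / (b.factorial : ℝ)) ∂P) = _
    rw [ofReal_integral_eq_lintegral_ofReal]
    · refine lintegral_congr fun ω => ?_
      rw [ENNReal.ofReal_mul (hnn a (h0 ω))]
      rfl
    · refine Integrable.of_bound (Measurable.aestronglyMeasurable ?_) 1 (ae_of_all _ fun ω => ?_)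
      · simp only [Function.comp_def] at hm0 hm1
        fun_prop
      · rw [Real.norm_of_nonneg (mul_nonneg (hnn a (h0 ω)) (hnn b (h1 ω)))]
        exact mul_le_one₀ (poissonWeight_toReal_le_one (h0 ω) a) (hnn b (h1 ω))
          (poissonWeight_toReal_le_one (h1 ω) b)
    · exact ae_of_all _ fun ω => mul_nonneg (hnn a (h0 ω)) (hnn b (h1 ω))
  · refine monotone_nat_of_le_succ fun n => ?_
    rcases n with _ | _ | n <;> simp [hsr]

lemma IsModelII.setLIntegral_pointCount_pair [IsFiniteMeasure P]
    (hM : IsModelII P Q p lam mu J T S)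
    (hlam : ∀ i, 0 ≤ lam i) {B : Set (RCPath d)} (hB : MeasurableSet B) {s r : ℝ≥0} (hsr : s ≤ r)
    (f : ℝ≥0∞ → ℝ≥0∞ → ℝ≥0∞) :
    ∫⁻ ω in hM.background.path ⁻¹' B, f (pointCount T 0 s ω) (pointCount T s r ω) ∂P =
      ∫⁻ ω in hM.background.path ⁻¹' B, ∑' a : ℕ, ∑' b : ℕ, f a b *
        (poissonWeight (cumRate lam (hM.background.path ω) 0 s) a *
        poissonWeight (cumRate lam (hM.background.path ω) s r) b) ∂P :=
  setLIntegral_of_poisson (hM.background.measurable_path hB)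
    (measurable_pointCount hM.measurable_arrival _ _)
    (measurable_pointCount hM.measurable_arrival _ _)
    ((measurable_cumRate bot_le).comp hM.background.measurable_path)
    ((measurable_cumRate hsr).comp hM.background.measurable_path)
    (fun _ => cumRate_nonneg hlam _ bot_le) (fun _ => cumRate_nonneg hlam _ hsr)
    (hM.measure_pointCount hlam hB hsr) f

lemma IsModelII.setLIntegral_pointCount [IsFiniteMeasure P] (hM : IsModelII P Q p lam mu J T S)
    (hlam : ∀ i, 0 ≤ lam i) {B : Set (RCPath d)} (hB : MeasurableSet B) (s : ℝ≥0) :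
    ∫⁻ ω in hM.background.path ⁻¹' B, pointCount T 0 s ω ∂P =
      ∫⁻ ω in hM.background.path ⁻¹' B,
        ENNReal.ofReal (cumRate lam (hM.background.path ω) 0 s) ∂P := by
  -- The second interval is (s, s], and its count is ignored by the test function.
  rw [hM.setLIntegral_pointCount_pair hlam hB (le_refl s) fun a _ => a]
  refine lintegral_congr fun ω => ?_
  simp only [← mul_assoc, ENNReal.tsum_mul_left, tsum_poissonWeight (cumRate_nonneg hlam _ le_rfl),
    mul_one, tsum_mul_poissonWeight (cumRate_nonneg hlam (hM.background.path ω) (zero_le (a := s)))]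

/-- For s ≤ r, the count on (0, r] is the count on (0, s] plus a conditionally independent one. The
extra term, with the minimum of s and r, is the Poisson variance of the common part. -/
lemma IsModelII.setLIntegral_pointCount_mul [IsFiniteMeasure P]
    (hM : IsModelII P Q p lam mu J T S)
    (hlam : ∀ i, 0 ≤ lam i) {B : Set (RCPath d)} (hB : MeasurableSet B) (s r : ℝ≥0) :
    ∫⁻ ω in hM.background.path ⁻¹' B, pointCount T 0 s ω * pointCount T 0 r ω ∂P =
      ∫⁻ ω in hM.background.path ⁻¹' B,
        (ENNReal.ofReal (cumRate lam (hM.background.path ω) 0 s) *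
          ENNReal.ofReal (cumRate lam (hM.background.path ω) 0 r) +
        ENNReal.ofReal (cumRate lam (hM.background.path ω) 0 (min s r))) ∂P := by
  wlog hsr : s ≤ r generalizing s r
  · have := this r s (le_of_not_ge hsr)
    simpa only [mul_comm, min_comm] using this
  have h1 := hM.setLIntegral_pointCount_pair hlam hB hsr fun a b => a * (a + b)
  simp only [pointCount_add zero_le hsr] at h1
  rw [h1, min_eq_left hsr]
  refine lintegral_congr fun ω => ?_
  set w := hM.background.path ω
  have h0 : 0 ≤ cumRate lam w 0 s := cumRate_nonneg hlam _ zero_le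
  have h2 : 0 ≤ cumRate lam w s r := cumRate_nonneg hlam _ hsr
  have h3 : ∀ a b : ℕ, ((a : ℝ≥0∞) * (a + b)) * (poissonWeight (cumRate lam w 0 s) a *
      poissonWeight (cumRate lam w s r) b) =
      (a * a * poissonWeight (cumRate lam w 0 s) a) * poissonWeight (cumRate lam w s r) b +
      (a * poissonWeight (cumRate lam w 0 s) a) * (b * poissonWeight (cumRate lam w s r) b) :=
    fun a b => by ring
  simp only [h3, ENNReal.tsum_add, ENNReal.tsum_mul_left, tsum_poissonWeight h2,
    tsum_mul_poissonWeight h2, ENNReal.tsum_mul_right, tsum_mul_poissonWeight h0,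
    tsum_sq_mul_poissonWeight h0, mul_one]
  rw [← cumRate_add w 0 s r, ENNReal.ofReal_add h0 h2]
  ring

end Campbell

/-! ### Intensity measures on paths and times -/

section Intensity

variable {d : ℕ} {lam : Fin d → ℝ}

/-- The arrival rate along a path, as an extended nonnegative real. -/
def pathRate (lam : Fin d → ℝ) (w : RCPath d) (s : ℝ) : ℝ≥0∞ :=
  ENNReal.ofReal (lam (w.1 s.toNNReal))

lemma measurable_pathRate : Measurable fun x : RCPath d × ℝ => pathRate lam x.1 x.2 :=
  ENNReal.measurable_ofReal.comp ((measurable_of_finite lam).comp measurable_pathEval)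

lemma measurable_pathRate_left (w : RCPath d) : Measurable (pathRate lam w) :=
  measurable_pathRate.comp measurable_prodMk_left

lemma measurable_ofReal_cumRate (a : ℝ≥0) :
    Measurable fun w : RCPath d => ENNReal.ofReal (cumRate lam w 0 a) :=
  ENNReal.measurable_ofReal.comp (measurable_cumRate zero_le)

lemma pathRate_le (w : RCPath d) (s : ℝ) : pathRate lam w s ≤ ENNReal.ofReal (∑ i, |lam i|) :=
  ENNReal.ofReal_le_ofReal ((le_abs_self _).trans
    (Finset.single_le_sum (f := fun i => |lam i|) (fun _ _ => abs_nonneg _) (Finset.mem_univ _)))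

lemma setLIntegral_pathRate (hlam : ∀ i, 0 ≤ lam i) (K : ℝ≥0) (w : RCPath d) (a : ℝ) :
    ∫⁻ s in Set.Iic a, pathRate lam w s ∂(volume.restrict (Set.Ioc (0 : ℝ) K)) =
      ENNReal.ofReal (cumRate lam w 0 (min K a.toNNReal)) := by
  rw [ofReal_cumRate hlam, Measure.restrict_restrict measurableSet_Iic]
  have : Set.Iic a ∩ Set.Ioc 0 (K : ℝ) = Set.Ioc 0 ((min K a.toNNReal : ℝ≥0) : ℝ) := by
    ext x
    simp only [Set.mem_inter_iff, Set.mem_Iic, Set.mem_Ioc, NNReal.coe_min, Real.coe_toNNReal',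
      le_min_iff, le_max_iff]
    constructor
    · rintro ⟨h1, h2, h3⟩; exact ⟨h2, h3, Or.inl h1⟩
    · rintro ⟨h1, h2, h3⟩; exact ⟨h3.resolve_right (not_le.2 h1), h1, h2⟩
  rw [this]
  rfl

/-- The intensity measure of the arrivals up to time `K`, jointly with the path. -/
def intensity (lam : Fin d → ℝ) (K : ℝ≥0) (μ : Measure (RCPath d)) : Measure (RCPath d × ℝ) :=
  (μ.prod (volume.restrict (Set.Ioc (0 : ℝ) K))).withDensity fun x => pathRate lam x.1 x.2

/-- The second factorial intensity of the arrivals up to time `K`, jointly with the path. -/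
def intensityPair (lam : Fin d → ℝ) (K : ℝ≥0) (μ : Measure (RCPath d)) :
    Measure (RCPath d × ℝ × ℝ) :=
  (μ.prod ((volume.restrict (Set.Ioc (0 : ℝ) K)).prod
    (volume.restrict (Set.Ioc (0 : ℝ) K)))).withDensity
      fun x => pathRate lam x.1 x.2.1 * pathRate lam x.1 x.2.2

variable {K : ℝ≥0} {μ : Measure (RCPath d)}

lemma measurable_pathRate_pair : Measurable fun x : RCPath d × ℝ × ℝ =>
    pathRate lam x.1 x.2.1 * pathRate lam x.1 x.2.2 :=
  (measurable_pathRate.comp (measurable_fst.prodMk measurable_snd.fst)).mul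
    (measurable_pathRate.comp (measurable_fst.prodMk measurable_snd.snd))

instance isFiniteMeasure_intensity [IsFiniteMeasure μ] : IsFiniteMeasure (intensity lam K μ) := by
  refine isFiniteMeasure_withDensity (ne_top_of_le_ne_top ?_
    (lintegral_mono fun x => pathRate_le x.1 x.2))
  rw [lintegral_const]
  exact ENNReal.mul_ne_top ENNReal.ofReal_ne_top (measure_ne_top _ _)

instance isFiniteMeasure_intensityPair [IsFiniteMeasure μ] : IsFiniteMeasure (intensityPair lam K
    μ) := by
  refine isFiniteMeasure_withDensity (ne_top_of_le_ne_top ?_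
    (lintegral_mono fun x => mul_le_mul' (pathRate_le x.1 x.2.1) (pathRate_le x.1 x.2.2)))
  rw [lintegral_const]
  exact ENNReal.mul_ne_top (ENNReal.mul_ne_top ENNReal.ofReal_ne_top ENNReal.ofReal_ne_top)
    (measure_ne_top _ _)

lemma intensity_prod_Iic [SFinite μ] (hlam : ∀ i, 0 ≤ lam i) {B : Set (RCPath d)} (hB :
    MeasurableSet B)
    (a : ℝ) : intensity lam K μ (B ×ˢ Set.Iic a) =
      ∫⁻ w in B, ENNReal.ofReal (cumRate lam w 0 (min K a.toNNReal)) ∂μ := by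
  rw [intensity, withDensity_apply _ (hB.prod measurableSet_Iic),
    setLIntegral_prod _ measurable_pathRate.aemeasurable]
  exact lintegral_congr fun w => setLIntegral_pathRate hlam K w a

lemma intensityPair_prod_Iic [SFinite μ] (hlam : ∀ i, 0 ≤ lam i) {B : Set (RCPath d)} (hB :
    MeasurableSet B)
    (a b : ℝ) : intensityPair lam K μ (B ×ˢ Set.Iic a ×ˢ Set.Iic b) =
      ∫⁻ w in B, ENNReal.ofReal (cumRate lam w 0 (min K a.toNNReal)) *
        ENNReal.ofReal (cumRate lam w 0 (min K b.toNNReal)) ∂μ := by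
  rw [intensityPair, withDensity_apply _ (hB.prod (measurableSet_Iic.prod measurableSet_Iic)),
    setLIntegral_prod _ measurable_pathRate_pair.aemeasurable]
  refine lintegral_congr fun w => ?_
  rw [← Measure.prod_restrict, lintegral_prod_mul (measurable_pathRate_left w).aemeasurable
    (measurable_pathRate_left w).aemeasurable, setLIntegral_pathRate hlam K w a,
    setLIntegral_pathRate hlam K w b]

lemma lintegral_intensity {F : RCPath d × ℝ → ℝ≥0∞} (hF : Measurable F) :
    ∫⁻ x, F x ∂(intensity lam K μ) =
      ∫⁻ w, (∫⁻ s in Set.Ioc (0 : ℝ) K, pathRate lam w s * F (w, s)) ∂μ := by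
  rw [intensity, lintegral_withDensity_eq_lintegral_mul _ measurable_pathRate hF,
    lintegral_prod _ (measurable_pathRate.mul hF).aemeasurable]
  rfl

lemma lintegral_intensityPair {F : RCPath d × ℝ × ℝ → ℝ≥0∞} (hF : Measurable F) :
    ∫⁻ x, F x ∂(intensityPair lam K μ) =
      ∫⁻ w, ∫⁻ y, pathRate lam w y.1 * pathRate lam w y.2 * F (w, y)
        ∂((volume.restrict (Set.Ioc (0 : ℝ) K)).prod (volume.restrict (Set.Ioc (0 : ℝ) K))) ∂μ := by
  rw [intensityPair, lintegral_withDensity_eq_lintegral_mul _ measurable_pathRate_pair hF,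
    lintegral_prod _ (measurable_pathRate_pair.mul hF).aemeasurable]
  rfl

end Intensity

section PointCount

lemma pointCount_zero {Ω : Type*} {T : ℕ → Ω → ℝ≥0∞} (hT : ∀ ω n, 0 < T n ω) (b : ℝ≥0) (ω : Ω) :
    pointCount T 0 b ω = ∑' n, {ω | T n ω ≤ b}.indicator 1 ω := by
  refine tsum_congr fun n => ?_
  simp [Set.indicator_apply, hT ω n]

lemma tsum_mul_tsum_eq (f g : ℕ → ℝ≥0∞) :
    (∑' a, f a) * ∑' b, g b = ∑' a, ∑' b, f a * g b := by
  simp only [← ENNReal.tsum_mul_right, ENNReal.tsum_mul_left]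

end PointCount

/-! ### Campbell formulas of first and second order -/

section Campbell

variable {d : ℕ} {Ω : Type*} [mΩ : MeasurableSpace Ω] {P : Measure Ω}
  {Q : Matrix (Fin d) (Fin d) ℝ} {p lam mu : Fin d → ℝ} {J : ℝ≥0 → Ω → Fin d}
  {T : ℕ → Ω → ℝ≥0∞} {S : ℕ → Ω → ℝ≥0}

/-- Positivity of x matters when a ≤ 0: `toNNReal` then gives 0, and both sides are false. The bound
by K excludes ⊤, whose `toReal` would be 0. -/
lemma le_and_toReal_le_iff {x : ℝ≥0∞} (hx : 0 < x) (K : ℝ≥0) (a : ℝ) :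
    (x ≤ K ∧ x.toReal ≤ a) ↔ x ≤ (min K a.toNNReal : ℝ≥0) := by
  rcases eq_or_ne x ⊤ with rfl | hx'
  · simp
  lift x to ℝ≥0 using hx'
  have hx0 : (0 : ℝ) < x := by exact_mod_cast hx
  have key : (x : ℝ) ≤ a ↔ x ≤ a.toNNReal := by
    rcases le_or_gt a 0 with ha | ha
    · rw [Real.toNNReal_of_nonpos ha]
      exact ⟨fun h => absurd (h.trans ha) (not_le.2 hx0),
        fun h => absurd h (not_le.2 (by exact_mod_cast hx0))⟩
    · rw [Real.le_toNNReal_iff_coe_le ha.le]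
  simp only [ENNReal.coe_toReal, ENNReal.coe_le_coe, le_min_iff, key]

variable [IsFiniteMeasure P]

/-- **Campbell's formula** for the arrivals up to time `K`, jointly with the background path. -/
lemma IsModelII.sum_map_points (hM : IsModelII P Q p lam mu J T S) (hlam : ∀ i, 0 ≤ lam i)
    (K : ℝ≥0) :
    Measure.sum (fun n => (P.restrict {ω | T n ω ≤ K}).map
      fun ω => (hM.background.path ω, (T n ω).toReal)) =
      intensity lam K (P.map hM.background.path) := by
  have hφ := hM.background.measurable_path
  -- The equality is reversed because extensionality asks for finiteness of its left measure, which
  -- is known beforehand only for the intensity.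
  refine (measure_ext_of_prod_Iic fun B hB a => ?_).symm
  have hset : ∀ (n : ℕ) (b : ℝ≥0), MeasurableSet {ω | T n ω ≤ b} := fun n b =>
    measurableSet_le (hM.measurable_arrival n) measurable_const
  have hmeas : ∀ n, Measurable fun ω => (hM.background.path ω, (T n ω).toReal) := fun n =>
    hφ.prodMk (hM.measurable_arrival n).ennreal_toReal
  rw [intensity_prod_Iic hlam hB, setLIntegral_map hB (measurable_ofReal_cumRate _) hφ,
    ← hM.setLIntegral_pointCount hlam hB, Measure.sum_apply _ (hB.prod measurableSet_Iic)]
  simp only [pointCount_zero hM.arrival_pos]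
  rw [lintegral_tsum fun n => (measurable_one.indicator (hset n _)).aemeasurable]
  refine tsum_congr fun n => ?_
  rw [lintegral_indicator_one (hset n _), Measure.restrict_apply (hset n _),
    Measure.map_apply (hmeas n) (hB.prod measurableSet_Iic),
    Measure.restrict_apply (hmeas n (hB.prod measurableSet_Iic))]
  congr 1
  ext ω
  have := le_and_toReal_le_iff (hM.arrival_pos ω n) K a
  simp only [Set.mem_inter_iff, Set.mem_ofPred_eq, Set.mem_preimage, Set.mem_prod, Set.mem_Iic]
  tauto

/-- The second order **Campbell formula** for the arrivals up to time `K`, jointly with the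
background path. -/
lemma IsModelII.sum_map_points_pair (hM : IsModelII P Q p lam mu J T S) (hlam : ∀ i, 0 ≤ lam i)
    (K : ℝ≥0) :
    Measure.sum (fun c : ℕ × ℕ => (P.restrict {ω | T c.1 ω ≤ K ∧ T c.2 ω ≤ K}).map
      fun ω => (hM.background.path ω, (T c.1 ω).toReal, (T c.2 ω).toReal)) =
      intensityPair lam K (P.map hM.background.path) +
        (intensity lam K (P.map hM.background.path)).map fun x => (x.1, x.2, x.2) := by
  have hφ := hM.background.measurable_path
  have hdiag : Measurable fun x : RCPath d × ℝ => (x.1, x.2, x.2) := by fun_prop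
  have hset : ∀ (n : ℕ) (b : ℝ≥0), MeasurableSet {ω | T n ω ≤ b} := fun n b =>
    measurableSet_le (hM.measurable_arrival n) measurable_const
  refine (measure_ext_of_prod_Iic_Iic fun B hB a b => ?_).symm
  have hcum : Measurable fun w : RCPath d => ENNReal.ofReal (cumRate lam w 0 (min K a.toNNReal)) *
      ENNReal.ofReal (cumRate lam w 0 (min K b.toNNReal)) +
      ENNReal.ofReal (cumRate lam w 0 (min K (min a b).toNNReal)) :=
    ((measurable_ofReal_cumRate _).mul (measurable_ofReal_cumRate _)).add
      (measurable_ofReal_cumRate _)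
  have hR : MeasurableSet (B ×ˢ Set.Iic a ×ˢ Set.Iic b) :=
    hB.prod (measurableSet_Iic.prod measurableSet_Iic)
  have hmeas : ∀ c : ℕ × ℕ, Measurable fun ω =>
      (hM.background.path ω, (T c.1 ω).toReal, (T c.2 ω).toReal) := fun c =>
    hφ.prodMk ((hM.measurable_arrival c.1).ennreal_toReal.prodMk
      (hM.measurable_arrival c.2).ennreal_toReal)
  -- On the diagonal both constraints bear on the same time, which produces the minimum appearing in
  -- the Poisson variance term.
  have hpre : (fun x : RCPath d × ℝ => (x.1, x.2, x.2)) ⁻¹' (B ×ˢ Set.Iic a ×ˢ Set.Iic b) =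
      B ×ˢ Set.Iic (min a b) := by
    ext x; simp
  have hmin : min K (min a b).toNNReal = min (min K a.toNNReal) (min K b.toNNReal) := by
    rw [Monotone.map_min fun _ _ h => Real.toNNReal_mono h, min_min_min_comm, min_self]
  rw [Measure.add_apply, Measure.map_apply hdiag hR, hpre, intensityPair_prod_Iic hlam hB,
    intensity_prod_Iic hlam hB, ← lintegral_add_right _ (measurable_ofReal_cumRate _),
    setLIntegral_map hB hcum hφ, hmin,
    ← hM.setLIntegral_pointCount_mul hlam hB, Measure.sum_apply _ hR]
  simp only [pointCount_zero hM.arrival_pos, tsum_mul_tsum_eq]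
  rw [lintegral_tsum_tsum (g := fun m n ω =>
    {ω | T m ω ≤ (min K a.toNNReal : ℝ≥0)}.indicator (1 : Ω → ℝ≥0∞) ω *
      {ω | T n ω ≤ (min K b.toNNReal : ℝ≥0)}.indicator 1 ω) fun m n =>
    (measurable_one.indicator (hset m _)).mul (measurable_one.indicator (hset n _)),
    ENNReal.tsum_prod']
  refine tsum_congr fun m => tsum_congr fun n => ?_
  have hind : ∀ ω, {ω | T m ω ≤ (min K a.toNNReal : ℝ≥0)}.indicator (1 : Ω → ℝ≥0∞) ω *
      {ω | T n ω ≤ (min K b.toNNReal : ℝ≥0)}.indicator 1 ω =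
      ({ω | T m ω ≤ (min K a.toNNReal : ℝ≥0)} ∩
        {ω | T n ω ≤ (min K b.toNNReal : ℝ≥0)}).indicator 1 ω := fun ω => by
    rw [Set.inter_indicator_one]; rfl
  simp only [hind]
  rw [lintegral_indicator_one ((hset m _).inter (hset n _)),
    Measure.restrict_apply ((hset m _).inter (hset n _)),
    Measure.map_apply (hmeas (m, n)) hR, Measure.restrict_apply (hmeas (m, n) hR)]
  congr 1
  ext ω
  have h1 := le_and_toReal_le_iff (hM.arrival_pos ω m) K a
  have h2 := le_and_toReal_le_iff (hM.arrival_pos ω n) K b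
  simp only [Set.mem_inter_iff, Set.mem_ofPred_eq, Set.mem_preimage, Set.mem_prod, Set.mem_Iic]
  tauto

end Campbell

/-! ### Conditional law of the durations with random thresholds -/

section Durations

variable {d : ℕ} {Ω : Type*} [mΩ : MeasurableSpace Ω] {P : Measure Ω}
  {Q : Matrix (Fin d) (Fin d) ℝ} {p lam mu : Fin d → ℝ} {J : ℝ≥0 → Ω → Fin d}
  {T : ℕ → Ω → ℝ≥0∞} {S : ℕ → Ω → ℝ≥0}

lemma IsModelII.sigmaJT_le (hM : IsModelII P Q p lam mu J T S) : sigmaJT J T ≤ mΩ :=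
  sup_le hM.background.sigmaJ_le (measurable_pi_lambda _ hM.measurable_arrival).comap_le

lemma measurable_arrival_sigmaJT {Ω : Type*} (J : ℝ≥0 → Ω → Fin d) (T : ℕ → Ω → ℝ≥0∞) (n : ℕ) :
    Measurable[sigmaJT J T] (T n) :=
  (measurable_pi_apply n).comp ((comap_measurable (fun ω n => T n ω)).mono
    (le_sup_right : _ ≤ sigmaJT J T) le_rfl)

/-- The probability that a job of duration exponential with parameter `mu i`, where `i` is the state
found by the `n`-th job, exceeds `x`. -/
def survival (mu : Fin d → ℝ) (J : ℝ≥0 → Ω → Fin d) (T : ℕ → Ω → ℝ≥0∞) (n : ℕ) (x : ℝ≥0) (ω : Ω) :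
    ℝ≥0∞ :=
  ENNReal.ofReal (Real.exp (-(mu (J (T n ω).toNNReal ω) * (x : ℝ))))

lemma IsModelII.measurable_stateAtArrival (hM : IsModelII P Q p lam mu J T S) (n : ℕ) :
    Measurable fun ω => J (T n ω).toNNReal ω :=
  measurable_pathEval_nnreal.comp (hM.background.measurable_path.prodMk
    (hM.measurable_arrival n).ennreal_toNNReal)

lemma IsModelII.measurable_survival (hM : IsModelII P Q p lam mu J T S) (n : ℕ) {θ : Ω → ℝ≥0}
    (hθ : Measurable θ) : Measurable fun ω => survival mu J T n (θ ω) ω := by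
  have h : Measurable fun ω => mu (J (T n ω).toNNReal ω) :=
    (measurable_of_finite mu).comp (hM.measurable_stateAtArrival n)
  exact (h.mul (measurable_coe_nnreal_real.comp hθ)).neg.exp.ennreal_ofReal

lemma survival_le_one {Ω : Type*} {J : ℝ≥0 → Ω → Fin d} {T : ℕ → Ω → ℝ≥0∞}
    (hmu : ∀ i, 0 < mu i) (n : ℕ) (x : ℝ≥0) (ω : Ω) :
    survival mu J T n x ω ≤ 1 :=
  ENNReal.ofReal_le_one.2 (Real.exp_le_one_iff.2 (neg_nonpos.2 (mul_nonneg (hmu _).le x.2)))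

variable [IsFiniteMeasure P]

lemma IsModelII.measure_durations (hM : IsModelII P Q p lam mu J T S) (hmu : ∀ i, 0 < mu i)
    (F : Finset ℕ) (x : ℕ → ℝ≥0) {A : Set Ω} (hA : MeasurableSet[sigmaJT J T] A)
    (hfin : ∀ ω ∈ A, ∀ n ∈ F, T n ω < ⊤) :
    P (A ∩ {ω | ∀ n ∈ F, x n < S n ω}) = ∫⁻ ω in A, ∏ n ∈ F, survival mu J T n (x n) ω ∂P := by
  have h := hM.durations F x A hA hfin
  rw [← ENNReal.ofReal_toReal (measure_ne_top P _)]
  change ENNReal.ofReal (P.real _) = _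
  have hnn : ∀ ω, ∀ n ∈ F, 0 ≤ Real.exp (-(mu (J (T n ω).toNNReal ω) * (x n : ℝ))) :=
    fun ω n _ => (Real.exp_pos _).le
  rw [h, ofReal_integral_eq_lintegral_ofReal]
  · refine lintegral_congr fun ω => ?_
    rw [ENNReal.ofReal_prod_of_nonneg (hnn ω)]
    rfl
  · refine Integrable.of_bound (Measurable.aestronglyMeasurable ?_) 1 (ae_of_all _ fun ω => ?_)
    · have h : ∀ n, Measurable fun ω => mu (J (T n ω).toNNReal ω) := fun n =>
        (measurable_of_finite mu).comp (hM.measurable_stateAtArrival n)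
      exact Finset.measurable_fun_prod _ fun n _ => ((h n).mul_const _).neg.exp
    · rw [Real.norm_of_nonneg (Finset.prod_nonneg (hnn ω))]
      exact Finset.prod_le_one (hnn ω) fun n _ =>
        Real.exp_le_one_iff.2 (neg_nonpos.2 (mul_nonneg (hmu _).le (x n).2))
  · exact ae_of_all _ fun ω => Finset.prod_nonneg (hnn ω)

/-- A is cut into countably many pieces according to the values of the finitely many indices N n.
Each piece belongs to the conditioning σ-algebra and has constant thresholds. -/
lemma IsModelII.measure_durations_discrete (hM : IsModelII P Q p lam mu J T S)
    (hmu : ∀ i, 0 < mu i) (F : Finset ℕ) (x : ℕ → ℝ≥0) {N : ℕ → Ω → ℕ}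
    (hN : ∀ n, Measurable[sigmaJT J T] (N n)) {A : Set Ω} (hA : MeasurableSet[sigmaJT J T] A)
    (hfin : ∀ ω ∈ A, ∀ n ∈ F, T n ω < ⊤) :
    P (A ∩ {ω | ∀ n ∈ F, x (N n ω) < S n ω}) =
      ∫⁻ ω in A, ∏ n ∈ F, survival mu J T n (x (N n ω)) ω ∂P := by
  let D : (F → ℕ) → Set Ω := fun c => A ∩ ⋂ n : F, {ω | N n ω = c n}
  have hD' : ∀ c, MeasurableSet[sigmaJT J T] (D c) := fun c =>
    hA.inter (MeasurableSet.iInter fun n => hN n (measurableSet_singleton _))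
  have hD : ∀ c, MeasurableSet (D c) := fun c => hM.sigmaJT_le _ (hD' c)
  have hU : A = ⋃ c, D c := by
    ext ω
    simp only [D, Set.mem_iUnion, Set.mem_inter_iff, Set.mem_iInter, Set.mem_ofPred_eq]
    exact ⟨fun h => ⟨fun n => N n ω, h, fun _ => rfl⟩, fun ⟨_, h, _⟩ => h⟩
  have hdisj : Pairwise (Function.onFun Disjoint D) := by
    intro c c' hc
    refine Set.disjoint_left.2 fun ω h1 h2 => hc (funext fun n => ?_)
    exact (Set.mem_iInter.1 h1.2 n).symm.trans (Set.mem_iInter.1 h2.2 n)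
  have hE : MeasurableSet {ω | ∀ n ∈ F, x (N n ω) < S n ω} := by
    simp only [Set.ofPred_forall]
    exact MeasurableSet.biInter (Set.to_countable _) fun n _ => measurableSet_lt
      ((measurable_of_countable x).comp ((hN n).mono hM.sigmaJT_le le_rfl))
      (hM.measurable_duration n)
  conv_lhs => rw [hU, Set.iUnion_inter]
  conv_rhs => rw [hU, lintegral_iUnion hD hdisj]
  rw [measure_iUnion (fun c c' hc => (hdisj hc).mono Set.inter_subset_left Set.inter_subset_left)
    fun c => (hD c).inter hE]
  refine tsum_congr fun c => ?_
  -- The threshold 0 outside F is never used.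
  have key := hM.measure_durations hmu F (fun n => if h : n ∈ F then x (c ⟨n, h⟩) else 0) (hD' c)
    fun ω hω => hfin ω hω.1
  have hc : ∀ ω ∈ D c, ∀ n ∈ F, (if h : n ∈ F then x (c ⟨n, h⟩) else 0) = x (N n ω) := by
    intro ω hω n hn
    have hcn : N n ω = c ⟨n, hn⟩ := Set.mem_iInter.1 hω.2 ⟨n, hn⟩
    rw [dif_pos hn, hcn]
  calc P (D c ∩ {ω | ∀ n ∈ F, x (N n ω) < S n ω})
      = P (D c ∩ {ω | ∀ n ∈ F, (if h : n ∈ F then x (c ⟨n, h⟩) else 0) < S n ω}) := by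
        congr 1
        ext ω
        refine and_congr_right fun hω => forall₂_congr fun n hn => ?_
        rw [hc ω hω n hn]
    _ = _ := key
    _ = _ := by
        refine setLIntegral_congr_fun (hD c) fun ω hω => ?_
        refine Finset.prod_congr rfl fun n hn => ?_
        simp only [hc ω hω n hn]

/-- The conditional law of the durations, with thresholds that depend on the background process and
the arrival times. -/
lemma IsModelII.measure_durations_random (hM : IsModelII P Q p lam mu J T S)
    (hmu : ∀ i, 0 < mu i) (F : Finset ℕ) {θ : ℕ → Ω → ℝ≥0}
    (hθ : ∀ n, Measurable[sigmaJT J T] (θ n)) {A : Set Ω} (hA : MeasurableSet[sigmaJT J T] A)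
    (hfin : ∀ ω ∈ A, ∀ n ∈ F, T n ω < ⊤) :
    P (A ∩ {ω | ∀ n ∈ F, θ n ω < S n ω}) =
      ∫⁻ ω in A, ∏ n ∈ F, survival mu J T n (θ n ω) ω ∂P := by
  -- Approximation strictly from above is essential: it makes the events {θk < S} converge pointwise
  -- to {θ < S} even where S = θ.
  let θk : ℕ → ℕ → Ω → ℝ≥0 := fun k n ω => ((⌊(k + 1 : ℝ≥0) * θ n ω⌋₊ : ℝ≥0) + 1) / (k + 1)
  have hθ' : ∀ n, Measurable (θ n) := fun n => (hθ n).mono hM.sigmaJT_le le_rfl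
  have hθk : ∀ k n, Measurable (θk k n) := fun k n =>
    ((measurable_from_top.comp (Nat.measurable_floor.comp ((hθ' n).const_mul _))).add_const
      1).div_const _
  have hlim : ∀ n ω, Tendsto (fun k => θk k n ω) atTop (𝓝[>] (θ n ω)) := fun n ω =>
    tendsto_floor_succ_div (θ n ω)
  have hlt : ∀ k n ω, θ n ω < θk k n ω := fun k n ω => by
    rw [lt_div_iff₀ (by positivity), mul_comm]
    exact Nat.lt_floor_add_one _
  have hk : ∀ k, P (A ∩ {ω | ∀ n ∈ F, θk k n ω < S n ω}) =
      ∫⁻ ω in A, ∏ n ∈ F, survival mu J T n (θk k n ω) ω ∂P := fun k =>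
    hM.measure_durations_discrete hmu F (fun m => ((m : ℝ≥0) + 1) / (k + 1))
      (N := fun n ω => ⌊(k + 1 : ℝ≥0) * θ n ω⌋₊)
      (fun n => Nat.measurable_floor.comp ((hθ n).const_mul _)) hA hfin
  have hE : ∀ ϑ : ℕ → Ω → ℝ≥0, (∀ n, Measurable (ϑ n)) →
      MeasurableSet (A ∩ {ω | ∀ n ∈ F, ϑ n ω < S n ω}) := fun ϑ h => by
    refine (hM.sigmaJT_le _ hA).inter ?_
    simp only [Set.ofPred_forall]
    exact MeasurableSet.biInter (Set.to_countable _) fun n _ => measurableSet_lt (h n)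
      (hM.measurable_duration n)
  have hL : Tendsto (fun k => P (A ∩ {ω | ∀ n ∈ F, θk k n ω < S n ω})) atTop
      (𝓝 (P (A ∩ {ω | ∀ n ∈ F, θ n ω < S n ω}))) := by
    refine tendsto_measure_of_tendsto_indicator_of_isFiniteMeasure atTop P
      (fun k => hE _ (hθk k)) fun ω => ?_
    by_cases h : ∀ n ∈ F, θ n ω < S n ω
    · have hev : ∀ᶠ k in atTop, ∀ n ∈ F, θk k n ω < S n ω := by
        rw [Filter.eventually_all_finset]
        exact fun n hn => (tendsto_nhdsWithin_iff.1 (hlim n ω)).1.eventually_lt_const (h n hn)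
      filter_upwards [hev] with k hk
      exact and_congr_right fun _ => ⟨fun _ => h, fun _ => hk⟩
    · refine Eventually.of_forall fun k => and_congr_right fun _ => ?_
      exact ⟨fun h' n hn => (hlt k n ω).trans (h' n hn), fun h' => absurd h' h⟩
  have hR : Tendsto (fun k => ∫⁻ ω in A, ∏ n ∈ F, survival mu J T n (θk k n ω) ω ∂P) atTop
      (𝓝 (∫⁻ ω in A, ∏ n ∈ F, survival mu J T n (θ n ω) ω ∂P)) := by
    refine tendsto_lintegral_of_dominated_convergence (fun _ => 1)
      (fun k => Finset.measurable_fun_prod _ fun n _ => hM.measurable_survival n (hθk k n))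
      (fun k => ae_of_all _ fun ω => Finset.prod_le_one' fun n _ => survival_le_one hmu n _ ω)
      (by simp) (ae_of_all _ fun ω => ?_)
    refine ENNReal.tendsto_finsetProd_of_ne_top _ (fun n _ => ?_) fun n _ => ENNReal.ofReal_ne_top
    refine ENNReal.tendsto_ofReal ((Real.continuous_exp.tendsto _).comp ?_)
    exact ((NNReal.tendsto_coe.2 (tendsto_nhdsWithin_iff.1 (hlim n ω)).1).const_mul _).neg
  simp only [hk] at hL
  exact tendsto_nhds_unique hL hR

end Durations

/-! ### Presence of jobs given path and arrival times -/

section Presence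

variable {d : ℕ}

/-- The conditional probability that a job that arrives at time `x.2 ≤ a` while the background
process follows the path `x.1` is still present at time `b`; zero if `a < x.2`. -/
def presence (mu : Fin d → ℝ) (a b : ℝ≥0) (x : RCPath d × ℝ) : ℝ≥0∞ :=
  (Set.Iic (a : ℝ)).indicator
    (fun s => ENNReal.ofReal (Real.exp (-(mu (x.1.1 s.toNNReal) * (b - s))))) x.2

lemma measurable_presence (mu : Fin d → ℝ) (a b : ℝ≥0) : Measurable (presence mu a b) := by
  have h : Measurable fun x : RCPath d × ℝ => mu (x.1.1 x.2.toNNReal) :=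
    (measurable_of_finite mu).comp measurable_pathEval
  exact Measurable.indicator (s := Prod.snd ⁻¹' Set.Iic (a : ℝ))
    (f := fun x : RCPath d × ℝ => ENNReal.ofReal (Real.exp (-(mu (x.1.1 x.2.toNNReal) * (b -
        x.2)))))
    (h.mul (measurable_snd.const_sub _)).neg.exp.ennreal_ofReal (measurable_snd measurableSet_Iic)

lemma presence_le_one {mu : Fin d → ℝ} (hmu : ∀ i, 0 < mu i) {a b : ℝ≥0} (hab : a ≤ b)
    (x : RCPath d × ℝ) : presence mu a b x ≤ 1 := by
  refine Set.indicator_apply_le' (fun hx => ?_) fun _ => zero_le_one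
  refine ENNReal.ofReal_le_one.2 (Real.exp_le_one_iff.2 (neg_nonpos.2 (mul_nonneg (hmu _).le ?_)))
  exact sub_nonneg.2 (le_trans hx (NNReal.coe_le_coe.2 hab))

lemma lintegral_intensity_ne_top {lam mu : Fin d → ℝ} (hmu : ∀ i, 0 < mu i) {a b : ℝ≥0}
    (hab : a ≤ b) (K : ℝ≥0) (μ : Measure (RCPath d)) [IsFiniteMeasure μ] :
    ∫⁻ x, presence mu a b x ∂(intensity lam K μ) ≠ ⊤ :=
  ne_top_of_le_ne_top (by simp) (lintegral_mono fun x => presence_le_one hmu hab x)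

lemma lintegral_intensityPair_ne_top {lam mu : Fin d → ℝ} (hmu : ∀ i, 0 < mu i) (a b : ℝ≥0)
    (K : ℝ≥0) (μ : Measure (RCPath d)) [IsFiniteMeasure μ] :
    ∫⁻ x, presence mu a a (x.1, x.2.1) * presence mu b b (x.1, x.2.2) ∂(intensityPair lam K μ) ≠ ⊤
        :=
  ne_top_of_le_ne_top (b := ∫⁻ _, 1 ∂(intensityPair lam K μ)) (by simp) (lintegral_mono fun x =>
    mul_le_one' (presence_le_one hmu le_rfl _) (presence_le_one hmu le_rfl _))

end Presence

section PresentJobs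

variable {Ω : Type*}

/-- The event that the `n`-th job has arrived by time `a` and does not leave by time `b`. -/
def presentOn (T : ℕ → Ω → ℝ≥0∞) (S : ℕ → Ω → ℝ≥0) (n : ℕ) (a b : ℝ≥0) : Set Ω :=
  {ω | T n ω ≤ a ∧ (b : ℝ≥0∞) < T n ω + S n ω}

/-- The number of jobs present at time `t`, as an extended nonnegative real. -/
def presentCount (T : ℕ → Ω → ℝ≥0∞) (S : ℕ → Ω → ℝ≥0) (t : ℝ≥0) (ω : Ω) : ℝ≥0∞ :=
  ∑' n, (presentOn T S n t t).indicator 1 ω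

variable {T : ℕ → Ω → ℝ≥0∞} {S : ℕ → Ω → ℝ≥0}

lemma jobsPresent_eq_toReal (t : ℝ≥0) (ω : Ω) :
    (jobsPresent T S t ω : ℝ) = (presentCount T S t ω).toReal := by
  have h : presentCount T S t ω =
      ({n | T n ω ≤ (t : ℝ≥0∞) ∧ (t : ℝ≥0∞) < T n ω + (S n ω : ℝ≥0∞)} : Set ℕ).encard := by
    rw [← tsum_indicator_eq_encard]
    rfl
  rw [h, jobsPresent, Set.ncard]
  generalize Set.encard _ = e
  cases e <;> simp

lemma lt_add_iff_toNNReal_sub_lt {x : ℝ≥0∞} {b s : ℝ≥0} (hx : x ≤ b) :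
    (b : ℝ≥0∞) < x + s ↔ ((b : ℝ≥0∞) - x).toNNReal < s := by
  lift x to ℝ≥0 using ne_top_of_le_ne_top ENNReal.coe_ne_top hx
  rw [← ENNReal.coe_sub, ENNReal.toNNReal_coe, ← ENNReal.coe_add, ENNReal.coe_lt_coe,
    tsub_lt_iff_left (by exact_mod_cast hx)]

lemma presentOn_inter {n : ℕ} {a b : ℝ≥0} (hab : a ≤ b) :
    presentOn T S n a a ∩ presentOn T S n b b = presentOn T S n a b := by
  have h : (a : ℝ≥0∞) ≤ b := by exact_mod_cast hab
  ext ω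
  exact ⟨fun h' => ⟨h'.1.1, h'.2.2⟩, fun h' => ⟨⟨h'.1, h.trans_lt h'.2⟩, h'.1.trans h, h'.2⟩⟩

lemma tsum_tsum_eq_offDiag_add_diag (g : ℕ → ℕ → ℝ≥0∞) :
    ∑' n, ∑' m, g n m = (∑' n, ∑' m, if m = n then 0 else g n m) + ∑' n, g n n := by
  rw [← ENNReal.tsum_add]
  refine tsum_congr fun n => ?_
  rw [← tsum_ite_eq n (g n), ← ENNReal.tsum_add]
  refine tsum_congr fun m => ?_
  split_ifs with h <;> simp [h]

lemma setLIntegral_eq_of_subset [MeasurableSpace Ω] {P : Measure Ω} {A B : Set Ω}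
    (hA : MeasurableSet A) (hB : MeasurableSet B) (hAB : A ⊆ B) {f : Ω → ℝ≥0∞}
    (hf : ∀ ω ∈ B, ω ∉ A → f ω = 0) : ∫⁻ ω in A, f ω ∂P = ∫⁻ ω in B, f ω ∂P := by
  rw [← lintegral_indicator hA, ← lintegral_indicator hB]
  congr 1
  ext ω
  by_cases h : ω ∈ A
  · rw [Set.indicator_of_mem h, Set.indicator_of_mem (hAB h)]
  · by_cases h' : ω ∈ B
    · rw [Set.indicator_of_notMem h, Set.indicator_of_mem h', hf ω h' h]
    · rw [Set.indicator_of_notMem h, Set.indicator_of_notMem h']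

end PresentJobs

/-! ### First and second moments of the number of jobs present -/

section Moments

variable {d : ℕ} {Ω : Type*} [mΩ : MeasurableSpace Ω] {P : Measure Ω}
  {Q : Matrix (Fin d) (Fin d) ℝ} {p lam mu : Fin d → ℝ} {J : ℝ≥0 → Ω → Fin d}
  {T : ℕ → Ω → ℝ≥0∞} {S : ℕ → Ω → ℝ≥0}

lemma IsModelII.measurableSet_presentOn (hM : IsModelII P Q p lam mu J T S) (n : ℕ) (a b : ℝ≥0) :
    MeasurableSet (presentOn T S n a b) :=
  (measurableSet_le (hM.measurable_arrival n) measurable_const).inter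
    (measurableSet_lt measurable_const ((hM.measurable_arrival n).add
      (hM.measurable_duration n).coe_nnreal_ennreal))

lemma IsModelII.measurable_presentCount (hM : IsModelII P Q p lam mu J T S) (t : ℝ≥0) :
    Measurable (presentCount T S t) :=
  Measurable.tsum fun n => measurable_one.indicator (hM.measurableSet_presentOn n t t)

lemma IsModelII.survival_eq_presence (hM : IsModelII P Q p lam mu J T S) {n : ℕ} {a b : ℝ≥0}
    (hab : a ≤ b) {ω : Ω} (hω : T n ω ≤ a) :
    survival mu J T n ((b : ℝ≥0∞) - T n ω).toNNReal ω =
      presence mu a b (hM.background.path ω, (T n ω).toReal) := by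
  have h1 : (T n ω).toReal ≤ a := ENNReal.toReal_le_coe_of_le_coe hω
  have h2 : T n ω ≤ b := hω.trans (by exact_mod_cast hab)
  have h3 : ((((b : ℝ≥0∞) - T n ω).toNNReal : ℝ≥0) : ℝ) = b - (T n ω).toReal := by
    rw [ENNReal.coe_toNNReal_eq_toReal, ENNReal.toReal_sub_of_le h2 ENNReal.coe_ne_top,
      ENNReal.coe_toReal]
  rw [presence, Set.indicator_of_mem (Set.mem_Iic.2 h1), survival, h3]
  simp only [ENNReal.toReal, Real.toNNReal_coe]
  rfl

lemma presence_eq_zero {w : RCPath d} {x : ℝ≥0∞} {a b : ℝ≥0} (hx : x ≠ ⊤) (h : ¬ x ≤ a) :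
    presence mu a b (w, x.toReal) = 0 := by
  lift x to ℝ≥0 using hx
  refine Set.indicator_of_notMem (fun h' => h ?_) _
  exact_mod_cast (Set.mem_Iic.1 h' : (x : ℝ) ≤ a)

lemma measurable_threshold_sigmaJT {Ω : Type*} (J : ℝ≥0 → Ω → Fin d) (T : ℕ → Ω → ℝ≥0∞) (n : ℕ)
    (b : ℝ≥0) : Measurable[sigmaJT J T] fun ω => ((b : ℝ≥0∞) - T n ω).toNNReal :=
  ENNReal.measurable_toNNReal.comp ((measurable_arrival_sigmaJT J T n).const_sub _)

lemma measurableSet_arrival_le_sigmaJT {Ω : Type*} (J : ℝ≥0 → Ω → Fin d) (T : ℕ → Ω → ℝ≥0∞)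
    (n : ℕ) (a : ℝ≥0) : MeasurableSet[sigmaJT J T] {ω | T n ω ≤ a} :=
  measurable_arrival_sigmaJT J T n measurableSet_Iic

variable [IsFiniteMeasure P]

/-- Presence until b means that the duration exceeds b - T n, a threshold known given the arrival
times. Since `presence` vanishes for arrivals after a, the integral extends to any horizon K, which
puts all jobs in the form required by Campbell's formula. -/
lemma IsModelII.measure_presentOn (hM : IsModelII P Q p lam mu J T S) (hmu : ∀ i, 0 < mu i)
    (n : ℕ) {a b K : ℝ≥0} (hab : a ≤ b) (haK : a ≤ K) :
    P (presentOn T S n a b) = ∫⁻ ω in {ω | T n ω ≤ K},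
      presence mu a b (hM.background.path ω, (T n ω).toReal) ∂P := by
  have haK' : (a : ℝ≥0∞) ≤ K := by exact_mod_cast haK
  have hab' : (a : ℝ≥0∞) ≤ b := by exact_mod_cast hab
  have key := hM.measure_durations_random hmu {n}
    (fun k => measurable_threshold_sigmaJT J T k b) (measurableSet_arrival_le_sigmaJT J T n a)
    (fun ω hω k hk => by
      rw [Finset.mem_singleton.1 hk]; exact lt_of_le_of_lt hω ENNReal.coe_lt_top)
  have hset : presentOn T S n a b = {ω | T n ω ≤ a} ∩
      {ω | ∀ k ∈ ({n} : Finset ℕ), ((b : ℝ≥0∞) - T k ω).toNNReal < S k ω} := by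
    ext ω
    refine and_congr_right fun hω => ?_
    simp only [Finset.mem_singleton, forall_eq]
    exact lt_add_iff_toNNReal_sub_lt (le_trans hω hab')
  have hm : ∀ c : ℝ≥0, MeasurableSet {ω | T n ω ≤ c} := fun c =>
    measurableSet_le (hM.measurable_arrival n) measurable_const
  rw [hset, key]
  simp only [Finset.prod_singleton]
  rw [setLIntegral_congr_fun (hm a) fun ω hω => hM.survival_eq_presence hab hω]
  refine setLIntegral_eq_of_subset (hm a) (hm K) (fun ω hω => le_trans hω haK') fun ω hω h => ?_
  exact presence_eq_zero (ne_top_of_le_ne_top ENNReal.coe_ne_top hω) h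

/-- Durations of different jobs are conditionally independent, so the presence probabilities
multiply; this fails for m = n, where one duration decides both events. -/
lemma IsModelII.measure_presentOn_inter (hM : IsModelII P Q p lam mu J T S) (hmu : ∀ i, 0 < mu i)
    {n m : ℕ} (hnm : m ≠ n) {a b K : ℝ≥0} (haK : a ≤ K) (hbK : b ≤ K) :
    P (presentOn T S n a a ∩ presentOn T S m b b) = ∫⁻ ω in {ω | T n ω ≤ K ∧ T m ω ≤ K},
      presence mu a a (hM.background.path ω, (T n ω).toReal) *
        presence mu b b (hM.background.path ω, (T m ω).toReal) ∂P := by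
  have haK' : (a : ℝ≥0∞) ≤ K := by exact_mod_cast haK
  have hbK' : (b : ℝ≥0∞) ≤ K := by exact_mod_cast hbK
  have key := hM.measure_durations_random hmu {n, m}
    (fun k => measurable_threshold_sigmaJT J T k (if k = n then a else b))
    ((measurableSet_arrival_le_sigmaJT J T n a).inter (measurableSet_arrival_le_sigmaJT J T m b))
    (fun ω hω k hk => by
      rcases Finset.mem_insert.1 hk with rfl | hk
      · exact lt_of_le_of_lt hω.1 ENNReal.coe_lt_top
      · rw [Finset.mem_singleton.1 hk]; exact lt_of_le_of_lt hω.2 ENNReal.coe_lt_top)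
  have hset : presentOn T S n a a ∩ presentOn T S m b b = ({ω | T n ω ≤ a} ∩ {ω | T m ω ≤ b}) ∩
      {ω | ∀ k ∈ ({n, m} : Finset ℕ),
        (((if k = n then a else b : ℝ≥0) : ℝ≥0∞) - T k ω).toNNReal < S k ω} := by
    ext ω
    refine (and_and_and_comm (a := T n ω ≤ a) (c := T m ω ≤ b)).trans (and_congr_right fun hω => ?_)
    simp only [Finset.mem_insert, Finset.mem_singleton, Set.mem_ofPred_eq, forall_eq_or_imp,
      forall_eq, if_true, if_neg hnm]
    exact and_congr (lt_add_iff_toNNReal_sub_lt hω.1) (lt_add_iff_toNNReal_sub_lt hω.2)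
  have hm : ∀ c e : ℝ≥0, MeasurableSet ({ω | T n ω ≤ c} ∩ {ω | T m ω ≤ e}) := fun c e =>
    (measurableSet_le (hM.measurable_arrival n) measurable_const).inter
      (measurableSet_le (hM.measurable_arrival m) measurable_const)
  rw [hset, key]
  simp only [Finset.prod_pair hnm.symm, if_true, if_neg hnm]
  rw [setLIntegral_congr_fun (g := fun ω =>
      presence mu a a (hM.background.path ω, (T n ω).toReal) *
        presence mu b b (hM.background.path ω, (T m ω).toReal)) (hm a b) fun ω hω => by
      simp only [hM.survival_eq_presence le_rfl hω.1, hM.survival_eq_presence le_rfl hω.2]]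
  refine setLIntegral_eq_of_subset (hm a b) (hm K K)
    (fun ω hω => ⟨le_trans hω.1 haK', le_trans hω.2 hbK'⟩) fun ω hω h => ?_
  rcases not_and_or.1 h with h | h
  · rw [presence_eq_zero (ne_top_of_le_ne_top ENNReal.coe_ne_top hω.1) h, zero_mul]
  · rw [presence_eq_zero (ne_top_of_le_ne_top ENNReal.coe_ne_top hω.2) h, mul_zero]

lemma IsModelII.tsum_lintegral_points (hM : IsModelII P Q p lam mu J T S) (hlam : ∀ i, 0 ≤ lam i)
    (K : ℝ≥0) {F : RCPath d × ℝ → ℝ≥0∞} (hF : Measurable F) :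
    ∑' n, ∫⁻ ω in {ω | T n ω ≤ K}, F (hM.background.path ω, (T n ω).toReal) ∂P =
      ∫⁻ x, F x ∂(intensity lam K (P.map hM.background.path)) := by
  rw [← hM.sum_map_points hlam K, lintegral_sum_measure]
  exact tsum_congr fun n => (lintegral_map hF (hM.background.measurable_path.prodMk
    (hM.measurable_arrival n).ennreal_toReal)).symm

lemma IsModelII.tsum_lintegral_points_pair (hM : IsModelII P Q p lam mu J T S)
    (hlam : ∀ i, 0 ≤ lam i) (K : ℝ≥0) {F : RCPath d × ℝ × ℝ → ℝ≥0∞} (hF : Measurable F) :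
    ∑' n, ∑' m, ∫⁻ ω in {ω | T n ω ≤ K ∧ T m ω ≤ K},
        F (hM.background.path ω, (T n ω).toReal, (T m ω).toReal) ∂P =
      ∫⁻ x, F x ∂(intensityPair lam K (P.map hM.background.path)) +
        ∫⁻ x, F (x.1, x.2, x.2) ∂(intensity lam K (P.map hM.background.path)) := by
  rw [← lintegral_map hF (by fun_prop : Measurable fun x : RCPath d × ℝ => (x.1, x.2, x.2)),
    ← lintegral_add_measure, ← hM.sum_map_points_pair hlam K, lintegral_sum_measure,
    ENNReal.tsum_prod']
  exact tsum_congr fun n => tsum_congr fun m =>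
    (lintegral_map hF (hM.background.measurable_path.prodMk
      ((hM.measurable_arrival n).ennreal_toReal.prodMk
        (hM.measurable_arrival m).ennreal_toReal))).symm

lemma IsModelII.lintegral_presentCount (hM : IsModelII P Q p lam mu J T S) (hlam : ∀ i, 0 ≤ lam i)
    (hmu : ∀ i, 0 < mu i) (t : ℝ≥0) :
    ∫⁻ ω, presentCount T S t ω ∂P =
      ∫⁻ x, presence mu t t x ∂(intensity lam t (P.map hM.background.path)) := by
  rw [← hM.tsum_lintegral_points hlam t (measurable_presence mu t t)]
  unfold presentCount
  rw [lintegral_tsum fun n =>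
    (measurable_one.indicator (hM.measurableSet_presentOn n t t)).aemeasurable]
  refine tsum_congr fun n => ?_
  rw [lintegral_indicator_one (hM.measurableSet_presentOn n t t),
    hM.measure_presentOn hmu n le_rfl le_rfl]

/-- Distinct jobs give the product of presences summed off the diagonal. The pair formula of
Campbell type sums over all pairs, so its diagonal, evaluated by the first-order formula, is
removed. The true diagonal is then put back: a single job that has arrived by a and stays until b.
-/
lemma IsModelII.lintegral_presentCount_mul (hM : IsModelII P Q p lam mu J T S)
    (hlam : ∀ i, 0 ≤ lam i) (hmu : ∀ i, 0 < mu i) {a b : ℝ≥0} (hab : a ≤ b) :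
    ∫⁻ ω, presentCount T S a ω * presentCount T S b ω ∂P =
      ∫⁻ x, presence mu a a (x.1, x.2.1) * presence mu b b (x.1, x.2.2)
          ∂(intensityPair lam b (P.map hM.background.path)) +
        ∫⁻ x, presence mu a b x ∂(intensity lam b (P.map hM.background.path)) := by
  have hset := hM.measurableSet_presentOn
  have hF : Measurable fun x : RCPath d × ℝ × ℝ =>
      presence mu a a (x.1, x.2.1) * presence mu b b (x.1, x.2.2) :=
    ((measurable_presence mu a a).comp (measurable_fst.prodMk measurable_snd.fst)).mul
      ((measurable_presence mu b b).comp (measurable_fst.prodMk measurable_snd.snd))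
  have hsum : ∫⁻ ω, presentCount T S a ω * presentCount T S b ω ∂P =
      ∑' n, ∑' m, P (presentOn T S n a a ∩ presentOn T S m b b) := by
    simp only [presentCount, tsum_mul_tsum_eq]
    rw [lintegral_tsum_tsum (g := fun n m ω => (presentOn T S n a a).indicator (1 : Ω → ℝ≥0∞) ω *
      (presentOn T S m b b).indicator 1 ω) fun n m =>
      (measurable_one.indicator (hset n a a)).mul (measurable_one.indicator (hset m b b))]
    refine tsum_congr fun n => tsum_congr fun m => ?_
    rw [← lintegral_indicator_one ((hset n a a).inter (hset m b b)), Set.inter_indicator_one]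
    rfl
  have hoff : (∑' n, ∑' m, if m = n then 0 else P (presentOn T S n a a ∩ presentOn T S m b b)) =
      ∑' n, ∑' m, if m = n then 0 else ∫⁻ ω in {ω | T n ω ≤ b ∧ T m ω ≤ b},
        presence mu a a (hM.background.path ω, (T n ω).toReal) *
          presence mu b b (hM.background.path ω, (T m ω).toReal) ∂P := by
    refine tsum_congr fun n => tsum_congr fun m => ?_
    split_ifs with h
    · rfl
    · exact hM.measure_presentOn_inter hmu h hab le_rfl
  have hall := hM.tsum_lintegral_points_pair hlam b hF
  have hdiag := hM.tsum_lintegral_points hlam b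
    (F := fun x => presence mu a a x * presence mu b b x)
    ((measurable_presence mu a a).mul (measurable_presence mu b b))
  rw [tsum_tsum_eq_offDiag_add_diag] at hall
  simp only [and_self, Prod.mk.eta] at hall
  rw [hdiag] at hall
  -- Removing the diagonal is a cancellation in `ℝ≥0∞`, which requires it to be finite.
  have hfin : ∫⁻ x, presence mu a a x * presence mu b b x
      ∂(intensity lam b (P.map hM.background.path)) ≠ ⊤ :=
    ne_top_of_le_ne_top (lintegral_intensity_ne_top hmu (le_refl a) b _) (lintegral_mono fun x =>
      mul_le_of_le_one_right' (presence_le_one hmu le_rfl x))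
  rw [hsum, tsum_tsum_eq_offDiag_add_diag, hoff, (ENNReal.add_left_inj hfin).1 hall]
  congr 1
  rw [← hM.tsum_lintegral_points hlam b (measurable_presence mu a b)]
  refine tsum_congr fun n => ?_
  rw [presentOn_inter hab, hM.measure_presentOn hmu n hab hab]

end Moments

/-! ### Two-time law of the stationary background chain -/

section JointLaw

variable {d : ℕ} {Ω : Type*} [mΩ : MeasurableSpace Ω] {P : Measure Ω}
  {Q : Matrix (Fin d) (Fin d) ℝ} {p : Fin d → ℝ} {J : ℝ≥0 → Ω → Fin d}

/-- The finite-dimensional laws always include time 0, so the initial state is summed out;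
invariance of p then removes the dependence on s. -/
lemma IsMarkovChain.measureReal_pair_of_le [IsFiniteMeasure P] (hJ : IsMarkovChain P Q p J)
    (hp : IsInvariantProb Q p)
    {s r : ℝ≥0} (hsr : s ≤ r) (i j : Fin d) :
    P.real {ω | J s ω = i ∧ J r ω = j} = p i * transProb Q (r - s) i j := by
  have h : ∀ k, P.real ({ω | J 0 ω = k} ∩ {ω | J s ω = i ∧ J r ω = j}) =
      p k * transProb Q s k i * transProb Q (r - s) i j := by
    intro k
    have h := hJ.finite_dim 2 (fun l => if l = 0 then 0 else if l = 1 then s else r)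
      (fun l => if l = 0 then k else if l = 1 then i else j)
      (monotone_nat_of_le_succ fun n => by rcases n with _ | _ | n <;> simp [hsr]) rfl
    simp only [Finset.prod_range_succ, Finset.prod_range_zero, one_mul, ↓reduceIte, zero_add,
      one_ne_zero, Nat.reduceAdd, OfNat.ofNat_ne_zero, OfNat.ofNat_ne_one, NNReal.coe_zero,
      sub_zero] at h
    rw [mul_assoc, ← h]
    congr 1
    ext ω
    simp only [Set.mem_inter_iff, Set.mem_ofPred_eq]
    refine ⟨fun h' l hl => ?_, fun h' => ⟨by simpa using h' 0 (by norm_num),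
      by simpa using h' 1 (by norm_num), by simpa using h' 2 (by norm_num)⟩⟩
    interval_cases l <;> simp [h']
  have hE : MeasurableSet {ω | J s ω = i ∧ J r ω = j} :=
    (hJ.measurable s (measurableSet_singleton i)).inter
      (hJ.measurable r (measurableSet_singleton j))
  have hsum := sum_measureReal_preimage_singleton
    (μ := P.restrict {ω | J s ω = i ∧ J r ω = j}) Finset.univ (f := J 0)
    (fun k _ => hJ.measurable 0 (measurableSet_singleton k))
  have hk : ∀ k, (P.restrict {ω | J s ω = i ∧ J r ω = j}).real (J 0 ⁻¹' {k}) =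
      p k * transProb Q s k i * transProb Q (r - s) i j := fun k => by
    rw [measureReal_restrict_apply (hJ.measurable 0 (measurableSet_singleton k)), ← h k]
    rfl
  simp only [hk, Finset.coe_univ, Set.preimage_univ, measureReal_restrict_apply MeasurableSet.univ,
    Set.univ_inter, ← Finset.sum_mul, invariant_transProb hp] at hsum
  exact hsum.symm

lemma IsMarkovChain.measureReal_pair [IsFiniteMeasure P] (hJ : IsMarkovChain P Q p J)
    (hp : IsInvariantProb Q p) (s r : ℝ≥0) (i j : Fin d) :
    P.real {ω | J s ω = i ∧ J r ω = j} = p i * p j + covKernel Q p i j (r - s) := by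
  rcases lt_or_ge s r with h | h
  · rw [hJ.measureReal_pair_of_le hp h.le, covKernel, if_pos (sub_pos.2 (NNReal.coe_lt_coe.2 h))]
    ring
  · simp only [and_comm (a := J s _ = i)]
    rw [hJ.measureReal_pair_of_le hp h, covKernel,
      if_neg (not_lt.2 (sub_nonpos.2 (NNReal.coe_le_coe.2 h))), neg_sub]
    ring

lemma IsMarkovChain.lintegral_pair [IsFiniteMeasure P] (hJ : IsMarkovChain P Q p J)
    (hp : IsInvariantProb Q p) {s r : ℝ≥0} {h : Fin d → Fin d → ℝ} (hh : ∀ i j, 0 ≤ h i j) :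
    ∫⁻ ω, ENNReal.ofReal (h (J s ω) (J r ω)) ∂P =
      ENNReal.ofReal (∑ i, ∑ j, h i j * (p i * p j + covKernel Q p i j (r - s))) := by
  have hX : Measurable fun ω => (J s ω, J r ω) := (hJ.measurable s).prodMk (hJ.measurable r)
  have hmap := lintegral_map (μ := P) (f := fun x : Fin d × Fin d => ENNReal.ofReal (h x.1 x.2))
    (measurable_of_finite _) hX
  have hpos : ∀ i j, 0 ≤ h i j * (p i * p j + covKernel Q p i j (r - s)) := fun i j => by
    rw [← hJ.measureReal_pair hp]
    exact mul_nonneg (hh i j) measureReal_nonneg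
  rw [← hmap, lintegral_fintype, Fintype.sum_prod_type,
    ENNReal.ofReal_sum_of_nonneg fun i _ => Finset.sum_nonneg fun j _ => hpos i j]
  refine Finset.sum_congr rfl fun i _ => ?_
  rw [ENNReal.ofReal_sum_of_nonneg fun j _ => hpos i j]
  refine Finset.sum_congr rfl fun j _ => ?_
  rw [ENNReal.ofReal_mul (hh i j), ← hJ.measureReal_pair hp, ofReal_measureReal,
    Measure.map_apply hX (measurableSet_singleton _)]
  congr 2
  ext ω
  simp

lemma IsMarkovChain.lintegral_single [IsFiniteMeasure P] (hJ : IsMarkovChain P Q p J)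
    (hp : IsInvariantProb Q p) {s : ℝ≥0} {h : Fin d → ℝ} (hh : ∀ i, 0 ≤ h i) :
    ∫⁻ ω, ENNReal.ofReal (h (J s ω)) ∂P = ENNReal.ofReal (∑ i, h i * p i) := by
  rw [hJ.lintegral_pair hp (s := s) (r := s) (h := fun i _ => h i) fun i _ => hh i]
  congr 1
  refine Finset.sum_congr rfl fun i _ => ?_
  rw [← Finset.mul_sum, Finset.sum_add_distrib, ← Finset.mul_sum, hp.sum_eq_one, mul_one]
  -- At lag 0 this is the covariance of an indicator with the constant 1.
  have h0 : ∑ j, covKernel Q p i j (s - s) = 0 := by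
    simp only [sub_self, covKernel, lt_irrefl, if_false, neg_zero, transProb_zero, mul_sub,
      Finset.sum_sub_distrib, mul_ite, mul_one, mul_zero, Finset.sum_ite_eq', Finset.mem_univ,
      if_true, ← Finset.sum_mul, hp.sum_eq_one, one_mul]
  rw [h0, add_zero]

end JointLaw

/-! ### Averaging the intensities over the background chain -/

section IntensityIntegrals

variable {d : ℕ} {Ω : Type*} [mΩ : MeasurableSpace Ω] {P : Measure Ω} [IsFiniteMeasure P]
  {Q : Matrix (Fin d) (Fin d) ℝ} {p lam mu : Fin d → ℝ} {J : ℝ≥0 → Ω → Fin d}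

lemma presence_of_mem {a b : ℝ≥0} {s : ℝ} (hs : s ∈ Set.Ioc (0 : ℝ) a) (w : RCPath d) :
    presence mu a b (w, s) = ENNReal.ofReal (Real.exp (-(mu (w.1 s.toNNReal) * (b - s)))) :=
  Set.indicator_of_mem (Set.mem_Iic.2 hs.2) _

lemma presence_of_notMem {a b : ℝ≥0} {s : ℝ} (hs0 : 0 < s) (hs : s ∉ Set.Ioc (0 : ℝ) a)
    (w : RCPath d) : presence mu a b (w, s) = 0 :=
  Set.indicator_of_notMem (s := Set.Iic (a : ℝ)) (fun h => hs ⟨hs0, h⟩) _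

/-- Tonelli exchanges path and time, after which only the law of the chain at a single time enters.
The pair version needs only the two-time law. -/
lemma IsMarkovChain.lintegral_presence (hJ : IsMarkovChain P Q p J) (hp : IsInvariantProb Q p)
    (hlam : ∀ i, 0 ≤ lam i) (a b : ℝ≥0) {K : ℝ≥0} (haK : a ≤ K) :
    ∫⁻ x, presence mu a b x ∂(intensity lam K (P.map hJ.path)) =
      ∫⁻ s in Set.Ioc (0 : ℝ) a,
        ENNReal.ofReal (∑ i, lam i * Real.exp (-(mu i * (b - s))) * p i) := by
  have hG : Measurable fun x : RCPath d × ℝ => pathRate lam x.1 x.2 * presence mu a b x :=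
    measurable_pathRate.mul (measurable_presence mu a b)
  rw [lintegral_intensity (measurable_presence mu a b),
    lintegral_lintegral_swap (f := fun w s => pathRate lam w s * presence mu a b (w, s))
      hG.aemeasurable]
  have hinner : ∀ s, ∫⁻ w, pathRate lam w s * presence mu a b (w, s) ∂(P.map hJ.path) =
      ∫⁻ ω, pathRate lam (hJ.path ω) s * presence mu a b (hJ.path ω, s) ∂P := fun s =>
    lintegral_map (f := fun w => pathRate lam w s * presence mu a b (w, s))
      (hG.comp (measurable_id.prodMk measurable_const)) hJ.measurable_path
  simp only [hinner]
  rw [← setLIntegral_eq_of_subset (A := Set.Ioc (0 : ℝ) a) measurableSet_Ioc measurableSet_Ioc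
    (Set.Ioc_subset_Ioc_right (NNReal.coe_le_coe.2 haK)) fun s hs hs' => by
      simp only [presence_of_notMem hs.1 hs', mul_zero, lintegral_zero]]
  refine setLIntegral_congr_fun measurableSet_Ioc fun s hs => ?_
  simp only [presence_of_mem hs, pathRate, ← ENNReal.ofReal_mul (hlam _)]
  exact hJ.lintegral_single hp (h := fun i => lam i * Real.exp (-(mu i * (b - s))))
    fun i => mul_nonneg (hlam i) (Real.exp_pos _).le

lemma IsMarkovChain.lintegral_presence_pair (hJ : IsMarkovChain P Q p J)
    (hp : IsInvariantProb Q p) (hlam : ∀ i, 0 ≤ lam i) {a b : ℝ≥0} (hab : a ≤ b) :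
    ∫⁻ x, presence mu a a (x.1, x.2.1) * presence mu b b (x.1, x.2.2)
        ∂(intensityPair lam b (P.map hJ.path)) =
      ∫⁻ y in Set.Ioc (0 : ℝ) a ×ˢ Set.Ioc (0 : ℝ) b, ENNReal.ofReal (∑ i, ∑ j,
        lam i * lam j * (Real.exp (-(mu i * (a - y.1))) * Real.exp (-(mu j * (b - y.2)))) *
          (p i * p j + covKernel Q p i j (y.2 - y.1))) ∂(volume.prod volume) := by
  have hF : Measurable fun x : RCPath d × ℝ × ℝ =>
      presence mu a a (x.1, x.2.1) * presence mu b b (x.1, x.2.2) :=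
    ((measurable_presence mu a a).comp (measurable_fst.prodMk measurable_snd.fst)).mul
      ((measurable_presence mu b b).comp (measurable_fst.prodMk measurable_snd.snd))
  have hG : Measurable fun x : RCPath d × ℝ × ℝ => pathRate lam x.1 x.2.1 * pathRate lam x.1 x.2.2 *
      (presence mu a a (x.1, x.2.1) * presence mu b b (x.1, x.2.2)) :=
    measurable_pathRate_pair.mul hF
  rw [lintegral_intensityPair hF,
    lintegral_lintegral_swap (f := fun w (y : ℝ × ℝ) => pathRate lam w y.1 * pathRate lam w y.2 *
      (presence mu a a (w, y.1) * presence mu b b (w, y.2))) hG.aemeasurable]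
  have hinner : ∀ y : ℝ × ℝ, ∫⁻ w, pathRate lam w y.1 * pathRate lam w y.2 *
      (presence mu a a (w, y.1) * presence mu b b (w, y.2)) ∂(P.map hJ.path) =
      ∫⁻ ω, pathRate lam (hJ.path ω) y.1 * pathRate lam (hJ.path ω) y.2 *
      (presence mu a a (hJ.path ω, y.1) * presence mu b b (hJ.path ω, y.2)) ∂P := fun y =>
    lintegral_map (f := fun w => pathRate lam w y.1 * pathRate lam w y.2 *
      (presence mu a a (w, y.1) * presence mu b b (w, y.2)))
      (hG.comp (measurable_id.prodMk measurable_const)) hJ.measurable_path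
  simp only [hinner]
  rw [Measure.prod_restrict, ← setLIntegral_eq_of_subset (A := Set.Ioc (0 : ℝ) a ×ˢ Set.Ioc (0 :
      ℝ) b)
    (measurableSet_Ioc.prod measurableSet_Ioc) (measurableSet_Ioc.prod measurableSet_Ioc)
    (Set.prod_mono (Set.Ioc_subset_Ioc_right (NNReal.coe_le_coe.2 hab)) le_rfl) fun y hy hy' => by
      have : y.1 ∉ Set.Ioc (0 : ℝ) a := fun h => hy' ⟨h, hy.2⟩
      simp only [presence_of_notMem hy.1.1 this, mul_zero, zero_mul, lintegral_zero]]
  refine setLIntegral_congr_fun (measurableSet_Ioc.prod measurableSet_Ioc) fun y hy => ?_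
  simp only [presence_of_mem hy.1, presence_of_mem hy.2, pathRate, ← ENNReal.ofReal_mul (hlam _),
    ← ENNReal.ofReal_mul (Real.exp_pos _).le,
    ← ENNReal.ofReal_mul (mul_nonneg (hlam _) (hlam _))]
  have h := hJ.lintegral_pair hp (s := y.1.toNNReal) (r := y.2.toNNReal) (h := fun i j =>
    lam i * lam j * (Real.exp (-(mu i * (a - y.1))) * Real.exp (-(mu j * (b - y.2)))))
    fun i j => mul_nonneg (mul_nonneg (hlam i) (hlam j))
      (mul_nonneg (Real.exp_pos _).le (Real.exp_pos _).le)
  rw [Real.coe_toNNReal _ hy.1.1.le, Real.coe_toNNReal _ hy.2.1.le] at h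
  exact h

end IntensityIntegrals

/-! ### Exact covariance formula -/

section Covariance

variable {d : ℕ} {Ω : Type*} [mΩ : MeasurableSpace Ω] {P : Measure Ω} [IsProbabilityMeasure P]
  {Q : Matrix (Fin d) (Fin d) ℝ} {p lam mu : Fin d → ℝ} {J : ℝ≥0 → Ω → Fin d}
  {T : ℕ → Ω → ℝ≥0∞} {S : ℕ → Ω → ℝ≥0}

lemma IsModelII.lintegral_presentCount_mul_ne_top (hM : IsModelII P Q p lam mu J T S)
    (hlam : ∀ i, 0 ≤ lam i) (hmu : ∀ i, 0 < mu i) {a b : ℝ≥0} (hab : a ≤ b) :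
    ∫⁻ ω, presentCount T S a ω * presentCount T S b ω ∂P ≠ ⊤ := by
  rw [hM.lintegral_presentCount_mul hlam hmu hab]
  exact ENNReal.add_ne_top.2 ⟨lintegral_intensityPair_ne_top hmu a b b _,
    lintegral_intensity_ne_top hmu hab b _⟩

/-- The number of jobs present has a finite second moment. -/
lemma IsModelII.memLp_jobsPresent (hM : IsModelII P Q p lam mu J T S) (hlam : ∀ i, 0 ≤ lam i)
    (hmu : ∀ i, 0 < mu i) (t : ℝ≥0) : MemLp (fun ω => (jobsPresent T S t ω : ℝ)) 2 P := by
  have hm := hM.measurable_presentCount t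
  simp only [jobsPresent_eq_toReal]
  rw [memLp_two_iff_integrable_sq hm.ennreal_toReal.aestronglyMeasurable]
  simp only [sq, ← ENNReal.toReal_mul]
  exact integrable_toReal_of_lintegral_ne_top (hm.mul hm).aemeasurable
    (hM.lintegral_presentCount_mul_ne_top hlam hmu le_rfl)

lemma IsModelII.integral_jobsPresent (hM : IsModelII P Q p lam mu J T S)
    (hp : IsInvariantProb Q p) (hlam : ∀ i, 0 ≤ lam i) (hmu : ∀ i, 0 < mu i) (t : ℝ≥0) :
    ∫ ω, (jobsPresent T S t ω : ℝ) ∂P =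
      ∫ s in Set.Ioc (0 : ℝ) t, ∑ i, lam i * Real.exp (-(mu i * (t - s))) * p i := by
  have hm := hM.measurable_presentCount t
  have h := hM.lintegral_presentCount hlam hmu t
  have hfin : ∫⁻ ω, presentCount T S t ω ∂P ≠ ⊤ := by
    rw [h]; exact lintegral_intensity_ne_top hmu le_rfl t _
  simp only [jobsPresent_eq_toReal]
  rw [integral_toReal hm.aemeasurable (ae_lt_top hm hfin), h,
    hM.background.lintegral_presence hp hlam t t le_rfl, integral_eq_lintegral_of_nonneg_ae]
  · exact ae_of_all _ fun s => Finset.sum_nonneg fun i _ =>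
      mul_nonneg (mul_nonneg (hlam i) (Real.exp_pos _).le) (hp.nonneg i)
  · exact Continuous.aestronglyMeasurable (by fun_prop)

lemma measurable_pairDensity (a b : ℝ) (i j : Fin d) : Measurable fun y : ℝ × ℝ =>
    Real.exp (-(mu i * (a - y.1))) * Real.exp (-(mu j * (b - y.2))) *
      covKernel Q p i j (y.2 - y.1) :=
  Measurable.mul (Continuous.measurable (by fun_prop))
    ((measurable_covKernel i j).comp (measurable_snd.sub measurable_fst))

lemma exp_neg_mul_sub_le_one (hmu : ∀ i, 0 < mu i) (i : Fin d) {a s : ℝ} (h : s ≤ a) :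
    Real.exp (-(mu i * (a - s))) ≤ 1 :=
  Real.exp_le_one_iff.2 (neg_nonpos.2 (mul_nonneg (hmu i).le (sub_nonneg.2 h)))

lemma integrableOn_pairDensity (hQ : IsIrreducibleGenerator Q) (hp : IsInvariantProb Q p)
    (hmu : ∀ i, 0 < mu i) (a b : ℝ) (i j : Fin d) :
    IntegrableOn (fun y : ℝ × ℝ => Real.exp (-(mu i * (a - y.1))) *
      Real.exp (-(mu j * (b - y.2))) * covKernel Q p i j (y.2 - y.1))
      (Set.Ioc 0 a ×ˢ Set.Ioc 0 b) (volume.prod volume) := by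
  have : IsFiniteMeasure (((volume : Measure ℝ).prod volume).restrict
      (Set.Ioc 0 a ×ˢ Set.Ioc 0 b)) := by
    rw [← Measure.prod_restrict]; infer_instance
  refine Integrable.of_bound (measurable_pairDensity a b i j).aestronglyMeasurable 2 ?_
  filter_upwards [ae_restrict_mem (measurableSet_Ioc.prod measurableSet_Ioc)] with y hy
  rw [Real.norm_eq_abs, abs_mul, abs_of_nonneg (by positivity)]
  calc _ ≤ 1 * |covKernel Q p i j (y.2 - y.1)| := by
        gcongr
        exact mul_le_one₀ (exp_neg_mul_sub_le_one hmu i hy.1.2) (Real.exp_pos _).le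
          (exp_neg_mul_sub_le_one hmu j hy.2.2)
    _ ≤ 2 := by rw [one_mul]; exact abs_covKernel_le hQ hp i j _

lemma integrableOn_pairDensity_const (hmu : ∀ i, 0 < mu i) (a b : ℝ) (i j : Fin d) :
    IntegrableOn (fun y : ℝ × ℝ => Real.exp (-(mu i * (a - y.1))) *
      Real.exp (-(mu j * (b - y.2)))) (Set.Ioc 0 a ×ˢ Set.Ioc 0 b) (volume.prod volume) := by
  have : IsFiniteMeasure (((volume : Measure ℝ).prod volume).restrict
      (Set.Ioc 0 a ×ˢ Set.Ioc 0 b)) := by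
    rw [← Measure.prod_restrict]; infer_instance
  refine Integrable.of_bound (Continuous.aestronglyMeasurable (by fun_prop)) 1 ?_
  filter_upwards [ae_restrict_mem (measurableSet_Ioc.prod measurableSet_Ioc)] with y hy
  rw [Real.norm_eq_abs, abs_of_nonneg (by positivity)]
  exact mul_le_one₀ (exp_neg_mul_sub_le_one hmu i hy.1.2) (Real.exp_pos _).le
    (exp_neg_mul_sub_le_one hmu j hy.2.2)

lemma measureReal_pair_nonneg (hQ : IsIrreducibleGenerator Q) (hp : IsInvariantProb Q p)
    (i j : Fin d) (x : ℝ) : 0 ≤ p i * p j + covKernel Q p i j x := by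
  unfold covKernel
  split_ifs with hx
  · have := mul_nonneg (hp.nonneg i) (transProb_nonneg hQ hx.le i j)
    linarith
  · have := mul_nonneg (hp.nonneg j) (transProb_nonneg hQ (neg_nonneg.2 (not_lt.1 hx)) j i)
    linarith

/-- The π_i π_j part of the joint law factorises into the product of the two means, isolating the
term that the covariance subtracts. -/
lemma integral_presence_pair (hQ : IsIrreducibleGenerator Q) (hp : IsInvariantProb Q p)
    (hlam : ∀ i, 0 ≤ lam i) (hmu : ∀ i, 0 < mu i) (a b : ℝ≥0) :
    (∫⁻ y in Set.Ioc (0 : ℝ) a ×ˢ Set.Ioc (0 : ℝ) b, ENNReal.ofReal (∑ i, ∑ j,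
        lam i * lam j * (Real.exp (-(mu i * (a - y.1))) * Real.exp (-(mu j * (b - y.2)))) *
          (p i * p j + covKernel Q p i j (y.2 - y.1))) ∂(volume.prod volume)).toReal =
      (∫ s in Set.Ioc (0 : ℝ) a, ∑ i, lam i * Real.exp (-(mu i * (a - s))) * p i) *
        (∫ s in Set.Ioc (0 : ℝ) b, ∑ i, lam i * Real.exp (-(mu i * (b - s))) * p i) +
      ∑ i, ∑ j, lam i * lam j * ∫ s in Set.Ioc (0 : ℝ) a, ∫ r in Set.Ioc (0 : ℝ) b,
        Real.exp (-(mu i * (a - s))) * Real.exp (-(mu j * (b - r))) *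
          covKernel Q p i j (r - s) := by
  have hI1 : ∀ i j, IntegrableOn (fun y : ℝ × ℝ => lam i * lam j * (p i * p j) *
      (Real.exp (-(mu i * (a - y.1))) * Real.exp (-(mu j * (b - y.2)))))
      (Set.Ioc (0 : ℝ) a ×ˢ Set.Ioc (0 : ℝ) b) (volume.prod volume) := fun i j =>
    (integrableOn_pairDensity_const hmu (a : ℝ) b i j).const_mul _
  have hI2 : ∀ i j, IntegrableOn (fun y : ℝ × ℝ => lam i * lam j *
      (Real.exp (-(mu i * (a - y.1))) * Real.exp (-(mu j * (b - y.2))) *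
        covKernel Q p i j (y.2 - y.1)))
      (Set.Ioc (0 : ℝ) a ×ˢ Set.Ioc (0 : ℝ) b) (volume.prod volume) := fun i j =>
    (integrableOn_pairDensity hQ hp hmu (a : ℝ) b i j).const_mul _
  have hsplit : ∀ y : ℝ × ℝ, (∑ i, ∑ j,
      lam i * lam j * (Real.exp (-(mu i * (a - y.1))) * Real.exp (-(mu j * (b - y.2)))) *
          (p i * p j + covKernel Q p i j (y.2 - y.1))) =
      (∑ i, ∑ j, lam i * lam j * (p i * p j) *
        (Real.exp (-(mu i * (a - y.1))) * Real.exp (-(mu j * (b - y.2))))) +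
      ∑ i, ∑ j, lam i * lam j * (Real.exp (-(mu i * (a - y.1))) * Real.exp (-(mu j * (b - y.2))) *
        covKernel Q p i j (y.2 - y.1)) := fun y => by
    simp only [← Finset.sum_add_distrib]
    exact Finset.sum_congr rfl fun i _ => Finset.sum_congr rfl fun j _ => by ring
  have hprod : ∀ y : ℝ × ℝ, (∑ i, ∑ j, lam i * lam j * (p i * p j) *
        (Real.exp (-(mu i * (a - y.1))) * Real.exp (-(mu j * (b - y.2))))) =
      (∑ i, lam i * Real.exp (-(mu i * (a - y.1))) * p i) *
        ∑ i, lam i * Real.exp (-(mu i * (b - y.2))) * p i := fun y => by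
    rw [Finset.sum_mul_sum]
    exact Finset.sum_congr rfl fun i _ => Finset.sum_congr rfl fun j _ => by ring
  rw [← integral_eq_lintegral_of_nonneg_ae]
  · simp only [hsplit]
    rw [integral_add (integrable_finsetSum _ fun i _ => integrable_finsetSum _ fun j _ => hI1 i j)
      (integrable_finsetSum _ fun i _ => integrable_finsetSum _ fun j _ => hI2 i j)]
    congr 1
    · simp only [hprod]
      exact setIntegral_prod_mul (fun s => ∑ i, lam i * Real.exp (-(mu i * (a - s))) * p i)
        (fun s => ∑ i, lam i * Real.exp (-(mu i * (b - s))) * p i) _ _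
    · rw [integral_finsetSum _ fun i _ => integrable_finsetSum _ fun j _ => hI2 i j]
      refine Finset.sum_congr rfl fun i _ => ?_
      rw [integral_finsetSum _ fun j _ => hI2 i j]
      refine Finset.sum_congr rfl fun j _ => ?_
      rw [integral_const_mul, setIntegral_prod _ (integrableOn_pairDensity hQ hp hmu (a : ℝ) b i j)]
  · exact ae_of_all _ fun y => Finset.sum_nonneg fun i _ => Finset.sum_nonneg fun j _ =>
      mul_nonneg (mul_nonneg (mul_nonneg (hlam i) (hlam j)) (by positivity))
        (measureReal_pair_nonneg hQ hp i j _)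
  · simp only [hsplit]
    exact ((integrable_finsetSum _ fun i _ => integrable_finsetSum _ fun j _ => hI1 i j).add
      (integrable_finsetSum _ fun i _ => integrable_finsetSum _ fun j _ => hI2 i j)).1

lemma integral_exp_neg_mul_sub {m : ℝ} (hm : 0 < m) (t u : ℝ≥0) :
    ∫ s in Set.Ioc (0 : ℝ) t, Real.exp (-(m * ((t + u : ℝ≥0) - s))) =
      Real.exp (-(m * u)) * ((1 - Real.exp (-(m * t))) / m) := by
  rw [← intervalIntegral.integral_of_le t.coe_nonneg]
  have hderiv : ∀ s ∈ Set.uIcc (0 : ℝ) t,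
      HasDerivAt (fun s => Real.exp (-(m * ((t + u : ℝ≥0) - s))) / m)
        (Real.exp (-(m * ((t + u : ℝ≥0) - s)))) s := by
    intro s _
    have h1 : HasDerivAt (fun s : ℝ => -(m * (((t + u : ℝ≥0) : ℝ) - s))) m s := by
      simpa using (((hasDerivAt_id s).const_sub ((t + u : ℝ≥0) : ℝ)).const_mul m).fun_neg
    have h2 := h1.exp.div_const m
    rwa [mul_div_assoc, div_self hm.ne', mul_one] at h2
  rw [intervalIntegral.integral_eq_sub_of_hasDerivAt hderiv
    (Continuous.intervalIntegrable (by fun_prop) _ _)]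
  have e1 : Real.exp (-(m * ((t + u : ℝ≥0) - (t : ℝ)))) = Real.exp (-(m * u)) := by
    congr 1; push_cast; ring
  have e2 : Real.exp (-(m * ((t + u : ℝ≥0) - (0 : ℝ)))) =
      Real.exp (-(m * u)) * Real.exp (-(m * t)) := by
    rw [← Real.exp_add]; congr 1; push_cast; ring
  rw [e1, e2]
  ring

/-- The covariance of the numbers of jobs present, in terms of the covariances of the states of the
background process. -/
lemma IsModelII.covJobs_eq (hM : IsModelII P Q p lam mu J T S) (hQ : IsIrreducibleGenerator Q)
    (hp : IsInvariantProb Q p) (hlam : ∀ i, 0 ≤ lam i) (hmu : ∀ i, 0 < mu i) (t u : ℝ≥0) :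
    covJobs P T S t u = (∑ i, Real.exp (-(mu i * u)) * rhoII p lam mu i t) +
      ∑ i, ∑ j, lam i * lam j * ∫ s in Set.Ioc (0 : ℝ) t, ∫ r in Set.Ioc (0 : ℝ) (t + u : ℝ≥0),
        Real.exp (-(mu i * (t - s))) * Real.exp (-(mu j * ((t + u : ℝ≥0) - r))) *
          covKernel Q p i j (r - s) := by
  have hab : t ≤ t + u := le_self_add
  have hm : Measurable fun ω => presentCount T S t ω * presentCount T S (t + u) ω :=
    (hM.measurable_presentCount t).mul (hM.measurable_presentCount (t + u))
  have hfin := hM.lintegral_presentCount_mul_ne_top hlam hmu hab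
  have h1 : ∫⁻ x, presence mu t t (x.1, x.2.1) * presence mu (t + u) (t + u) (x.1, x.2.2)
      ∂(intensityPair lam (t + u) (P.map hM.background.path)) ≠ ⊤ :=
    lintegral_intensityPair_ne_top hmu _ _ _ _
  have h2 : ∫⁻ x, presence mu t (t + u) x ∂(intensity lam (t + u) (P.map hM.background.path)) ≠ ⊤ :=
    lintegral_intensity_ne_top hmu hab _ _
  have hmean : ∫ ω, ((fun ω => (jobsPresent T S t ω : ℝ)) *
      fun ω => (jobsPresent T S (t + u) ω : ℝ)) ω ∂P =
      (∫⁻ ω, presentCount T S t ω * presentCount T S (t + u) ω ∂P).toReal := by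
    simp only [Pi.mul_apply, jobsPresent_eq_toReal, ← ENNReal.toReal_mul]
    exact integral_toReal hm.aemeasurable (ae_lt_top hm hfin)
  rw [covJobs, covariance_eq_sub (hM.memLp_jobsPresent hlam hmu t)
    (hM.memLp_jobsPresent hlam hmu (t + u)), hmean, hM.lintegral_presentCount_mul hlam hmu hab,
    ENNReal.toReal_add h1 h2, hM.background.lintegral_presence_pair hp hlam hab,
    hM.background.lintegral_presence hp hlam t (t + u) hab,
    integral_presence_pair hQ hp hlam hmu, hM.integral_jobsPresent hp hlam hmu,
    hM.integral_jobsPresent hp hlam hmu]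
  have h3 : (∫⁻ s in Set.Ioc (0 : ℝ) t, ENNReal.ofReal
      (∑ i, lam i * Real.exp (-(mu i * ((t + u : ℝ≥0) - s))) * p i)).toReal =
      ∑ i, Real.exp (-(mu i * u)) * rhoII p lam mu i t := by
    rw [← integral_eq_lintegral_of_nonneg_ae]
    · rw [integral_finsetSum]
      · refine Finset.sum_congr rfl fun i _ => ?_
        rw [integral_mul_const, integral_const_mul, integral_exp_neg_mul_sub (hmu i), rhoII]
        ring
      · intro i _
        exact (Continuous.integrableOn_Ioc (by fun_prop))
    · exact ae_of_all _ fun s => Finset.sum_nonneg fun i _ =>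
        mul_nonneg (mul_nonneg (hlam i) (Real.exp_pos _).le) (hp.nonneg i)
    · exact Continuous.aestronglyMeasurable (by fun_prop)
  -- The product of the means now occurs once with each sign and cancels.
  rw [h3]
  ring

end Covariance

/-! ### Scaling and asymptotics -/

section Scaling

variable {d : ℕ} {Q : Matrix (Fin d) (Fin d) ℝ} {p lam mu : Fin d → ℝ}

lemma IsIrreducibleGenerator.smul (hQ : IsIrreducibleGenerator Q) {c : ℝ} (hc : 0 < c) :
    IsIrreducibleGenerator (c • Q) where
  offDiag_nonneg i j hij := mul_nonneg hc.le (hQ.offDiag_nonneg i j hij)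
  row_sum i := by
    simp only [Matrix.smul_apply, ← Finset.smul_sum, hQ.row_sum, smul_zero]
  irreducible i j := (hQ.irreducible i j).lift id fun _ _ h => mul_pos hc h

lemma IsInvariantProb.smul (hp : IsInvariantProb Q p) (c : ℝ) : IsInvariantProb (c • Q) p where
  nonneg := hp.nonneg
  sum_eq_one := hp.sum_eq_one
  invariant := by rw [Matrix.vecMul_smul, hp.invariant, smul_zero]

lemma covKernel_smul {c : ℝ} (hc : 0 < c) (i j : Fin d) (x : ℝ) :
    covKernel (c • Q) p i j x = covKernel Q p i j (c * x) := by
  simp only [covKernel, transProb_smul, mul_pos_iff_of_pos_left hc, mul_neg]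

/-- The contribution of the background process to the covariance when its generator is `c • Q`,
multiplied by `c`. -/
def modulationTerm (Q : Matrix (Fin d) (Fin d) ℝ) (p lam mu : Fin d → ℝ) (t u : ℝ≥0) (c : ℝ) : ℝ :=
  ∑ i, ∑ j, lam i * lam j * (c * ∫ s in Set.Ioc (0 : ℝ) t, ∫ r in Set.Ioc (0 : ℝ) (t + u : ℝ≥0),
    Real.exp (-(mu i * (t - s))) * Real.exp (-(mu j * ((t + u : ℝ≥0) - r))) *
      covKernel Q p i j (c * (r - s)))

lemma tendsto_modulationTerm (hQ : IsIrreducibleGenerator Q) (hp : IsInvariantProb Q p)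
    (hmu : ∀ i, 0 < mu i) (t u : ℝ≥0) :
    Tendsto (modulationTerm Q p lam mu t u) atTop
      (𝓝 (∑ i, Real.exp (-(mu i * u)) * sigmaII Q p lam mu i t)) := by
  have hint : ∀ i j, ∫ s in Set.Ioc (0 : ℝ) t,
      Real.exp (-(mu i * (t - s))) * Real.exp (-(mu j * ((t + u : ℝ≥0) - s))) =
      Real.exp (-(mu j * u)) * ((1 - Real.exp (-((mu i + mu j) * t))) / (mu i + mu j)) := by
    intro i j
    have h := integral_exp_neg_mul_sub (add_pos (hmu i) (hmu j)) t 0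
    rw [add_zero, NNReal.coe_zero, mul_zero, neg_zero, Real.exp_zero, one_mul] at h
    rw [← h, ← integral_const_mul]
    refine integral_congr_ae (ae_of_all _ fun s => ?_)
    simp only [← Real.exp_add]
    congr 1
    push_cast
    ring
  have hlim : ∑ i, Real.exp (-(mu i * u)) * sigmaII Q p lam mu i t =
      ∑ i, ∑ j, lam i * lam j * ((∫ s in Set.Ioc (0 : ℝ) t,
        Real.exp (-(mu i * (t - s))) * Real.exp (-(mu j * ((t + u : ℝ≥0) - s)))) *
          ∫ x, covKernel Q p i j x) := by
    -- The later observation time attaches e^{-μ u} to the second index, so i and j are exchanged;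
    -- the remaining factors are symmetric in them.
    rw [Finset.sum_comm]
    refine Finset.sum_congr rfl fun i _ => ?_
    rw [sigmaII, Finset.mul_sum]
    refine Finset.sum_congr rfl fun j _ => ?_
    rw [hint, integral_covKernel hQ hp, add_comm (mu j)]
    ring
  rw [hlim]
  refine tendsto_finsetSum _ fun i _ => tendsto_finsetSum _ fun j _ => Tendsto.const_mul _ ?_
  have hle : ∀ (k : Fin d) {a s : ℝ}, s ≤ a → |Real.exp (-(mu k * (a - s)))| ≤ 1 :=
    fun k a s h => by rw [Real.abs_exp]; exact exp_neg_mul_sub_le_one hmu k h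
  exact tendsto_scaled_kernel (g := fun s => Real.exp (-(mu i * (t - s))))
    (h := fun r => Real.exp (-(mu j * ((t + u : ℝ≥0) - r))))
    (integrable_covKernel hQ hp i j) (measurable_covKernel i j) (by fun_prop) (by fun_prop)
    (NNReal.coe_le_coe.2 le_self_add) (fun s hs => hle i hs.2) fun r hr => hle j hr.2

/-- The arrival rates contribute N² = N^{2-α} N^α to the pair term. The factor N^α is the one that
normalises the kernel run at speed N^α. -/
lemma IsModelII.covJobs_scaled {Ω : Type*} [MeasurableSpace Ω] {P : Measure Ω}
    [IsProbabilityMeasure P] {J : ℝ≥0 → Ω → Fin d} {T : ℕ → Ω → ℝ≥0∞} {S : ℕ → Ω → ℝ≥0}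
    {N α : ℝ} (hN : 0 < N)
    (hM : IsModelII P ((N ^ α) • Q) p (fun i => N * lam i) mu J T S)
    (hQ : IsIrreducibleGenerator Q) (hp : IsInvariantProb Q p) (hlam : ∀ i, 0 ≤ lam i)
    (hmu : ∀ i, 0 < mu i) (t u : ℝ≥0) :
    covJobs P T S t u = N * (∑ i, Real.exp (-(mu i * u)) * rhoII p lam mu i t) +
      N ^ (2 - α) * modulationTerm Q p lam mu t u (N ^ α) := by
  have hc : 0 < N ^ α := Real.rpow_pos_of_pos hN α
  rw [hM.covJobs_eq (hQ.smul hc) (hp.smul _) (fun i => mul_nonneg hN.le (hlam i)) hmu]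
  congr 1
  · rw [Finset.mul_sum]
    refine Finset.sum_congr rfl fun i _ => ?_
    simp only [rhoII]
    ring
  · rw [modulationTerm, Finset.mul_sum]
    refine Finset.sum_congr rfl fun i _ => ?_
    rw [Finset.mul_sum]
    refine Finset.sum_congr rfl fun j _ => ?_
    have hpow : N ^ (2 - α) * N ^ α = N * N := by
      rw [← Real.rpow_add hN, sub_add_cancel, Real.rpow_two, sq]
    simp only [covKernel_smul hc]
    rw [mul_left_comm (N ^ (2 - α)), ← mul_assoc (N ^ (2 - α)), hpow]
    ring

lemma tendsto_rpow_sub_max (α : ℝ) : Tendsto (fun x : ℝ => x ^ (1 - max 1 (2 - α))) atTop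
    (𝓝 (if 1 ≤ α then 1 else 0)) := by
  split_ifs with h
  · rw [max_eq_left (by linarith)]
    simp
  · rw [max_eq_right (by linarith), show 1 - (2 - α) = -(1 - α) by ring]
    exact tendsto_rpow_neg_atTop (by linarith)

lemma tendsto_rpow_sub_max' (α : ℝ) : Tendsto (fun x : ℝ => x ^ (2 - α - max 1 (2 - α))) atTop
    (𝓝 (if α ≤ 1 then 1 else 0)) := by
  split_ifs with h
  · rw [max_eq_right (by linarith)]
    simp
  · rw [max_eq_left (by linarith), show 2 - α - 1 = -(α - 1) by ring]
    exact tendsto_rpow_neg_atTop (by linarith)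

lemma vII_eq (Q : Matrix (Fin d) (Fin d) ℝ) (p lam mu : Fin d → ℝ) (α t u : ℝ) :
    vII Q p lam mu α t u =
      (if 1 ≤ α then 1 else 0) * (∑ i, Real.exp (-(mu i * u)) * rhoII p lam mu i t) +
      (if α ≤ 1 then 1 else 0) * ∑ i, Real.exp (-(mu i * u)) * sigmaII Q p lam mu i t := by
  rw [vII, Finset.mul_sum, Finset.mul_sum, ← Finset.sum_add_distrib]
  refine Finset.sum_congr rfl fun i _ => ?_
  split_ifs <;> ring

/-- The function g is the modulation term when this is applied to the covariance, and its limit when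
applied to the two-term expression. At α = 1 both indicators equal 1. -/
lemma tendsto_two_term_div {ι : Type*} {l : Filter ι} {N : ι → ℝ} (hN0 : ∀ k, 0 < N k)
    (hN : Tendsto N l atTop) (α r : ℝ) {s : ℝ} {g : ι → ℝ} (hg : Tendsto g l (𝓝 s)) :
    Tendsto (fun k => (N k * r + N k ^ (2 - α) * g k) / N k ^ max 1 (2 - α)) l
      (𝓝 ((if 1 ≤ α then 1 else 0) * r + (if α ≤ 1 then 1 else 0) * s)) := by
  refine ((((tendsto_rpow_sub_max α).comp hN).mul_const r).add
    (((tendsto_rpow_sub_max' α).comp hN).mul hg)).congr fun k => ?_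
  simp only [Function.comp_apply, Real.rpow_sub (hN0 k) _ (max 1 (2 - α)), Real.rpow_one]
  ring

end Scaling

end MMInfServer

end

theorem mainTheorem6 {d : ℕ} (Q : Matrix (Fin d) (Fin d) ℝ) (p lam mu : Fin d → ℝ) (α : ℝ)
    (hQ : MMInfServer.IsIrreducibleGenerator Q) (hp : MMInfServer.IsInvariantProb Q p)
    (hlam : ∀ i, 0 ≤ lam i) (hmu : ∀ i, 0 < mu i) (hα : 0 < α)
    -- the scaling parameter, tending to infinity through positive reals (e.g. the integers)
    {ι : Type*} (l : Filter ι) (N : ι → ℝ) (hN0 : ∀ k, 0 < N k) (hN : Tendsto N l atTop)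
    -- for each value of it, a Model II system with arrival rates `N λ` and generator `N^α Q`
    (Ω : ι → Type*) [∀ k, MeasurableSpace (Ω k)] (P : ∀ k, Measure (Ω k))
    [∀ k, IsProbabilityMeasure (P k)]
    (J : ∀ k, ℝ≥0 → Ω k → Fin d) (T : ∀ k, ℕ → Ω k → ℝ≥0∞) (S : ∀ k, ℕ → Ω k → ℝ≥0)
    (hM : ∀ k, MMInfServer.IsModelII (P k) ((N k ^ α) • Q) p (fun i => N k * lam i) mu
      (J k) (T k) (S k))
    (t u : ℝ≥0) :
    -- the deviation matrix and the covariances are well defined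
    (∀ i j, IntegrableOn (fun r => MMInfServer.transProb Q r i j - p j) (Set.Ioi (0 : ℝ))) ∧
    (∀ k (s : ℝ≥0),
      MemLp (fun ω => (MMInfServer.jobsPresent (T k) (S k) s ω : ℝ)) 2 (P k)) ∧
    -- two-term behaviour of the covariance
    ((fun k => MMInfServer.covJobs (P k) (T k) (S k) t u -
        MMInfServer.twoTerm Q p lam mu α t u (N k)) =o[l] fun k => N k ^ (2 - α)) ∧
    (MMInfServer.vII Q p lam mu α t u ≠ 0 →
      (fun k => MMInfServer.covJobs (P k) (T k) (S k) t u) ~[l]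
        fun k => MMInfServer.twoTerm Q p lam mu α t u (N k)) ∧
    -- the limit
    Tendsto (fun k => MMInfServer.covJobs (P k) (T k) (S k) t u / N k ^ max 1 (2 - α)) l
      (𝓝 (MMInfServer.vII Q p lam mu α t u)) := by
  have hmod : Tendsto (fun k => MMInfServer.modulationTerm Q p lam mu t u (N k ^ α)) l
      (𝓝 (∑ i, Real.exp (-(mu i * u)) * MMInfServer.sigmaII Q p lam mu i t)) :=
    (MMInfServer.tendsto_modulationTerm hQ hp hmu t u).comp ((tendsto_rpow_atTop hα).comp hN)
  have hcov : ∀ k, MMInfServer.covJobs (P k) (T k) (S k) t u =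
      N k * (∑ i, Real.exp (-(mu i * u)) * MMInfServer.rhoII p lam mu i t) +
        N k ^ (2 - α) * MMInfServer.modulationTerm Q p lam mu t u (N k ^ α) := fun k =>
    (hM k).covJobs_scaled (hN0 k) hQ hp hlam hmu t u
  have hlim : Tendsto (fun k => MMInfServer.covJobs (P k) (T k) (S k) t u /
      N k ^ max 1 (2 - α)) l (𝓝 (MMInfServer.vII Q p lam mu α t u)) := by
    simp only [hcov, MMInfServer.vII_eq]
    exact MMInfServer.tendsto_two_term_div hN0 hN α _ hmod
  have hlim' : Tendsto (fun k => MMInfServer.twoTerm Q p lam mu α t u (N k) /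
      N k ^ max 1 (2 - α)) l (𝓝 (MMInfServer.vII Q p lam mu α t u)) := by
    rw [MMInfServer.vII_eq]
    exact MMInfServer.tendsto_two_term_div hN0 hN α _ tendsto_const_nhds
  refine ⟨MMInfServer.integrableOn_transProb_sub hQ hp, fun k s =>
    (hM k).memLp_jobsPresent (fun i => mul_nonneg (hN0 k).le (hlam i)) hmu s, ?_, fun hv => ?_,
        hlim⟩
  -- The ϱ terms agree exactly, so the error is N^{2-α} times the difference between the modulation
  -- term and its limit.
  · have h0 := (isLittleO_one_iff ℝ).2 (tendsto_sub_nhds_zero_iff.2 hmod)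
    refine ((isBigO_refl (fun k => N k ^ (2 - α)) l).mul_isLittleO h0).congr (fun k => ?_)
      fun k => mul_one _
    rw [hcov, MMInfServer.twoTerm]
    ring
  -- Divided by the leading power of N, both sides tend to the same nonzero constant, hence are
  -- equivalent; multiplying back preserves this.
  · have h := (((isEquivalent_const_iff_tendsto hv).2 hlim).trans
      ((isEquivalent_const_iff_tendsto hv).2 hlim').symm).mul
      (IsEquivalent.refl (u := fun k => N k ^ max 1 (2 - α)) (l := l))
    refine (h.congr_left ?_).congr_right ?_
    all_goals
      refine Eventually.of_forall fun k => ?_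
      exact div_mul_cancel₀ _ (Real.rpow_pos_of_pos (hN0 k) _).ne'
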